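/- Let $F(t)=\sum_{n\ge 0} f_n t^n$ be a nonzero power series with real coefficients $f_n\ge 0$ and radius of convergence $R>0$. For $t\in(0,R)$ let $X_t$ be a $\mathbb{Z}_{\ge 0}$-valued random variable with $P[X_t=n]=f_nt^n/F(t)$, let $m(t)=E[X_t]$ be its mean, $\sigma^2(t)=E[(X_t-m(t))^2]$ its variance (with $\sigma(t)\ge 0$), and $Z(t)=(X_t-m(t))/\sigma(t)$. We say that $F$ satisfies the strong Gaussian condition if $$\lim_{t\to R^-}\int_{-\pi\sigma(t)}^{\pi\sigma(t)}\left|E\left[e^{i\theta Z(t)}\right]-e^{-\theta^2/2}\right|\,d\theta=0 .$$ **Theorem.** The power series $$H_2^*(t)=2^7\prod_{n=1}^{\infty}\left(\frac{1+t^{2n-1}}{1-t^{2n-1}}\right)^{16}\qquad\text{and}\qquad H_3^*(t)=2^{15}\,t^2\prod_{n=1}^{\infty}\left(\frac{1+t^{2n}}{1-t^{2n-1}}\right)^{16}$$ have nonnegative coefficients and radius of convergence $R=1$, and both satisfy the strong Gaussian condition, the limit being taken as $t\to 1^-$. -/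

import Mathlib

namespace StrongGaussian

open scoped ENNReal Topology

noncomputable section

/-- The radius of convergence of a real power series. -/
def radius (F : PowerSeries ℝ) : ℝ≥0∞ :=
  (FormalMultilinearSeries.ofScalars ℝ (fun n => PowerSeries.coeff n F)).radius

/-- The value `F(t) = ∑ fₙ tⁿ`. -/
def value (F : PowerSeries ℝ) (t : ℝ) : ℝ :=
  ∑' n : ℕ, PowerSeries.coeff n F * t ^ n

/-- The distribution of the random variable `X_t`: `P[X_t = n] = fₙ tⁿ / F(t)`. -/
def prob (F : PowerSeries ℝ) (t : ℝ) (n : ℕ) : ℝ :=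
  PowerSeries.coeff n F * t ^ n / value F t

/-- The expected value `E[ψ(X_t)] = ∑ ψ(n) P[X_t = n]`, for `ψ` with values in `ℝ` or `ℂ`. -/
def expect {E : Type*} [NormedAddCommGroup E] [NormedSpace ℝ E]
    (F : PowerSeries ℝ) (t : ℝ) (ψ : ℕ → E) : E :=
  ∑' n : ℕ, prob F t n • ψ n

/-- The mean `m(t) = E[X_t]`. -/
def mean (F : PowerSeries ℝ) (t : ℝ) : ℝ :=
  expect F t (fun n => (n : ℝ))

/-- The variance `σ²(t) = E[(X_t - m(t))²]`. -/
def variance (F : PowerSeries ℝ) (t : ℝ) : ℝ :=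
  expect F t (fun n => ((n : ℝ) - mean F t) ^ 2)

/-- The standard deviation `σ(t)`. -/
def stdDev (F : PowerSeries ℝ) (t : ℝ) : ℝ :=
  √(variance F t)

/-- The characteristic function `E[exp(iθ Z(t))]` of `Z(t) = (X_t - m(t)) / σ(t)`. -/
def charFunZ (F : PowerSeries ℝ) (t θ : ℝ) : ℂ :=
  expect F t (fun n =>
    Complex.exp (Complex.I * ((θ * (((n : ℝ) - mean F t) / stdDev F t) : ℝ) : ℂ)))

/-- The strong Gaussian condition for a nonzero power series `F` with nonnegative coefficients
and positive radius of convergence `R`. The limit is `t → R` from below; the filter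
`comap ENNReal.ofReal (𝓝[<] R)` is `𝓝[<] R` for finite `R > 0`, and `atTop` for `R = ∞`. -/
structure StrongGaussianCondition (F : PowerSeries ℝ) : Prop where
  ne_zero : F ≠ 0
  coeff_nonneg : ∀ n : ℕ, 0 ≤ PowerSeries.coeff n F
  radius_pos : 0 < radius F
  tendsto : Filter.Tendsto
    (fun t : ℝ => ∫ θ in (-(Real.pi * stdDev F t))..(Real.pi * stdDev F t),
      ‖charFunZ F t θ - (Real.exp (-(1 / 2) * θ ^ 2) : ℂ)‖)
    (Filter.comap ENNReal.ofReal (𝓝[<] (radius F))) (𝓝 0)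

open scoped PowerSeries.WithPiTopology in
/-- The formal products in the definitions of `H2Star` and `H3Star` converge. -/
theorem multipliable_factors (a b : ℕ → ℕ) (ha : ∀ n, n < a n) (hb : ∀ n, n < b n) :
    Multipliable (fun n : ℕ => ((1 + PowerSeries.X ^ (a n)) *
      (1 - PowerSeries.X ^ (b n) : PowerSeries ℝ)⁻¹) ^ 16) := by
  have key : ∀ n, (PowerSeries.X : PowerSeries ℝ) ^ (n + 1) ∣
      ((1 + PowerSeries.X ^ (a n)) * (1 - PowerSeries.X ^ (b n) : PowerSeries ℝ)⁻¹) ^ 16 - 1 := by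
    intro n
    have hc : PowerSeries.constantCoeff (1 - PowerSeries.X ^ (b n) : PowerSeries ℝ) ≠ 0 := by
      have : b n ≠ 0 := by have := hb n; omega
      simp [this]
    have hm := PowerSeries.mul_inv_cancel _ hc
    have e : (1 + PowerSeries.X ^ (a n)) * (1 - PowerSeries.X ^ (b n) : PowerSeries ℝ)⁻¹ - 1
        = (PowerSeries.X ^ (a n) + PowerSeries.X ^ (b n)) *
          (1 - PowerSeries.X ^ (b n) : PowerSeries ℝ)⁻¹ := by
      linear_combination hm
    have h1 : (PowerSeries.X : PowerSeries ℝ) ^ (n + 1) ∣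
        (1 + PowerSeries.X ^ (a n)) * (1 - PowerSeries.X ^ (b n) : PowerSeries ℝ)⁻¹ - 1 := by
      rw [e]
      exact Dvd.dvd.mul_right (dvd_add (pow_dvd_pow _ (ha n)) (pow_dvd_pow _ (hb n))) _
    refine h1.trans ?_
    have h2 := sub_dvd_pow_sub_pow
      ((1 + PowerSeries.X ^ (a n)) * (1 - PowerSeries.X ^ (b n) : PowerSeries ℝ)⁻¹) 1 16
    rwa [one_pow] at h2
  have h := PowerSeries.WithPiTopology.multipliable_one_add_of_tendsto_order_atTop_nhds_top (R := ℝ)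
    (f := fun n : ℕ => ((1 + PowerSeries.X ^ (a n)) *
      (1 - PowerSeries.X ^ (b n) : PowerSeries ℝ)⁻¹) ^ 16 - 1) (by
    refine ENat.tendsto_nhds_top_iff_natCast_lt.mpr
      (fun n => Filter.eventually_atTop.mpr ⟨n, fun m hm => ?_⟩)
    have := PowerSeries.X_pow_dvd_iff.mp (key m)
    refine lt_of_lt_of_le (b := ((m + 1 : ℕ) : ℕ∞)) (by exact_mod_cast Nat.lt_succ_of_le hm) ?_
    exact PowerSeries.le_order _ _ (fun i hi => this i (by exact_mod_cast hi)))
  simpa using h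

open scoped PowerSeries.WithPiTopology in
/-- `H₂*(t) = 2⁷ ∏_{n ≥ 1} ((1 + t^(2n-1)) / (1 - t^(2n-1)))¹⁶`, as a formal power series
(the index `n` below is `n - 1`; the infinite product converges coefficientwise). -/
def H2Star : PowerSeries ℝ :=
  2 ^ 7 * ∏' n : ℕ, ((1 + PowerSeries.X ^ (2 * n + 1)) *
    (1 - PowerSeries.X ^ (2 * n + 1) : PowerSeries ℝ)⁻¹) ^ 16

open scoped PowerSeries.WithPiTopology in
/-- `H₃*(t) = 2¹⁵ t² ∏_{n ≥ 1} ((1 + t^(2n)) / (1 - t^(2n-1)))¹⁶`, as a formal power series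
(the index `n` below is `n - 1`; the infinite product converges coefficientwise). -/
def H3Star : PowerSeries ℝ :=
  2 ^ 15 * PowerSeries.X ^ 2 * ∏' n : ℕ, ((1 + PowerSeries.X ^ (2 * n + 2)) *
    (1 - PowerSeries.X ^ (2 * n + 1) : PowerSeries ℝ)⁻¹) ^ 16

end

end StrongGaussian

open Filter Finset
open scoped Topology Nat

namespace StrongGaussian

noncomputable section

/-! Both series have the form C t^k ∏ ((1 + t^(a n)) / (1 - t^(2n+1)))^16 with a n > n. Put t =
exp(-s), s → 0+. The logarithm of the product is an absolutely convergent double series ∑ cᵢ exp(-eᵢ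
s), where i = (n, j), |cᵢ| ≤ 16/j and eᵢ is j times a n or 2n+1. If Λ is the logarithm of the value
at exp(-s), the mean is -Λ' and the variance is Λ''. Weighting the series by eᵢ^p costs a factor of
order s^(-p), which gives O(s^(-p-1)); keeping the terms j = 1 of the denominators bounds the
variance below, so σ² is of exact order s^(-3).

With ξ = θ/σ, the characteristic function of Z is exp(-iξm) F(t exp(iξ)) / F(t). Expanding its
exponent to second order leaves -θ²/2 and a remainder O(|ξ|³ s^(-4)) = O(|θ|³ s^(1/2)). Hence it
converges pointwise (`tendsto_charFunZ_model`).

Dominated convergence then needs an integrable bound on all of |ξ| ≤ π. Numerators are largest on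
the positive axis, so only denominators matter: |1 - z^b|² exceeds (1 - t^b)² by a factor 1 + gap,
and for odd b ≤ π / max(s, |ξ|) the gap is at least a constant times ξ²/s². There are at least 1 /
max(s, |ξ|) such b, and the product of the factors 1 + gap exceeds 1 plus their sum. The 16th power
then leaves enough room for the bound (1 + const · ξ²/s³)⁻¹ (`norm_exp_logProd_le_inv`), which is at
most (1 + cθ²)⁻¹ because σ² = O(s^(-3)). -/

/-- The power series `p` converges absolutely at `z`, with sum `v`. -/
structure HasValue (p : PowerSeries ℝ) (z v : ℂ) : Prop where
  summable : Summable (fun n => ‖((PowerSeries.coeff n p : ℝ) : ℂ) * z ^ n‖)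
  tsum_eq : ∑' n, ((PowerSeries.coeff n p : ℝ) : ℂ) * z ^ n = v

/-! ### Arithmetic of absolutely convergent power series -/

namespace HasValue

variable {p q : PowerSeries ℝ} {z v w : ℂ}

theorem hasSum (h : HasValue p z v) :
    HasSum (fun n => ((PowerSeries.coeff n p : ℝ) : ℂ) * z ^ n) v :=
  h.tsum_eq ▸ h.summable.of_norm.hasSum

theorem mul (hp : HasValue p z v) (hq : HasValue q z w) : HasValue (p * q) z (v * w) := by
  have key : ∀ n, ((PowerSeries.coeff n (p * q) : ℝ) : ℂ) * z ^ n =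
      ∑ kl ∈ antidiagonal n, (((PowerSeries.coeff kl.1 p : ℝ) : ℂ) * z ^ kl.1) *
        (((PowerSeries.coeff kl.2 q : ℝ) : ℂ) * z ^ kl.2) := by
    intro n
    rw [PowerSeries.coeff_mul, Complex.ofReal_sum, Finset.sum_mul]
    refine Finset.sum_congr rfl fun kl hkl => ?_
    rw [← mem_antidiagonal.mp hkl, Complex.ofReal_mul, pow_add]
    ring
  have h1 := summable_norm_sum_mul_antidiagonal_of_summable_norm hp.summable hq.summable
  have h2 := tsum_mul_tsum_eq_tsum_sum_antidiagonal_of_summable_norm hp.summable hq.summable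
  rw [hp.tsum_eq, hq.tsum_eq] at h2
  exact ⟨h1.congr fun n => by rw [key n], (tsum_congr key).trans h2.symm⟩

theorem of_support {s : Finset ℕ} (hs : ∀ n ∉ s, PowerSeries.coeff n p = 0)
    (hv : ∑ n ∈ s, ((PowerSeries.coeff n p : ℝ) : ℂ) * z ^ n = v) : HasValue p z v := by
  constructor
  · exact summable_of_ne_finset_zero (s := s) fun n hn => by simp [hs n hn]
  · rw [tsum_eq_sum (s := s) fun n hn => by simp [hs n hn], hv]

theorem add (hp : HasValue p z v) (hq : HasValue q z w) : HasValue (p + q) z (v + w) := by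
  have h : ∀ n, ((PowerSeries.coeff n (p + q) : ℝ) : ℂ) * z ^ n =
      ((PowerSeries.coeff n p : ℝ) : ℂ) * z ^ n + ((PowerSeries.coeff n q : ℝ) : ℂ) * z ^ n := by
    intro n
    simp [add_mul]
  constructor
  · simp_rw [h]
    exact (hp.summable.add hq.summable).of_nonneg_of_le (fun _ => norm_nonneg _)
      fun _ => norm_add_le _ _
  · simp_rw [h]
    exact (hp.hasSum.add hq.hasSum).tsum_eq

theorem monomial (k : ℕ) (c : ℝ) (z : ℂ) :
    HasValue (PowerSeries.monomial k c) z (c * z ^ k) := by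
  refine of_support (s := {k}) (fun n hn => ?_) ?_
  · rw [PowerSeries.coeff_monomial, if_neg (by simpa using hn)]
  · simp [PowerSeries.coeff_monomial]

theorem X_pow (k : ℕ) (z : ℂ) : HasValue (PowerSeries.X ^ k) z (z ^ k) := by
  simpa [PowerSeries.X_pow_eq] using monomial k 1 z

theorem one (z : ℂ) : HasValue 1 z 1 := by
  simpa using X_pow 0 z

theorem neg (hp : HasValue p z v) : HasValue (-p) z (-v) := by
  have h := (monomial 0 (-1) z).mul hp
  have e : PowerSeries.monomial 0 (-1 : ℝ) = -1 := by
    rw [map_neg, ← PowerSeries.X_pow_eq, pow_zero]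
  simpa [e] using h

theorem pow (hp : HasValue p z v) (n : ℕ) : HasValue (p ^ n) z (v ^ n) := by
  induction n with
  | zero => simpa using one z
  | succ n ih => simpa [pow_succ] using ih.mul hp

theorem prod {p : ℕ → PowerSeries ℝ} {v : ℕ → ℂ} (s : Finset ℕ)
    (h : ∀ n, HasValue (p n) z (v n)) : HasValue (∏ n ∈ s, p n) z (∏ n ∈ s, v n) := by
  induction s using Finset.induction_on with
  | empty => simpa using one z
  | insert a s ha ih => simpa [Finset.prod_insert ha] using (h a).mul ih

end HasValue

/-! ### Nonnegative coefficients and the infinite product -/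

/-- All coefficients of the power series are nonnegative. -/
def CoeffNonneg (p : PowerSeries ℝ) : Prop := ∀ n, 0 ≤ PowerSeries.coeff n p

namespace CoeffNonneg

variable {p q : PowerSeries ℝ}

theorem mul (hp : CoeffNonneg p) (hq : CoeffNonneg q) : CoeffNonneg (p * q) := fun n => by
  rw [PowerSeries.coeff_mul]
  exact Finset.sum_nonneg fun _ _ => mul_nonneg (hp _) (hq _)

theorem add (hp : CoeffNonneg p) (hq : CoeffNonneg q) : CoeffNonneg (p + q) := fun n => by
  rw [map_add]
  exact add_nonneg (hp n) (hq n)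

theorem X_pow (k : ℕ) : CoeffNonneg (PowerSeries.X ^ k) := fun n => by
  rw [PowerSeries.coeff_X_pow]
  split_ifs <;> norm_num

theorem one : CoeffNonneg 1 := by
  simpa using X_pow 0

end CoeffNonneg

theorem constantCoeff_one_sub_X_pow {b : ℕ} (hb : b ≠ 0) :
    PowerSeries.constantCoeff (1 - PowerSeries.X ^ b : PowerSeries ℝ) ≠ 0 := by
  simp [hb]

theorem geom_eq {b : ℕ} (hb : b ≠ 0) :
    (1 - PowerSeries.X ^ b : PowerSeries ℝ)⁻¹ =
      1 + PowerSeries.X ^ b * (1 - PowerSeries.X ^ b : PowerSeries ℝ)⁻¹ := by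
  have h := PowerSeries.mul_inv_cancel _ (constantCoeff_one_sub_X_pow hb)
  linear_combination h

theorem coeff_geom_mem_Icc {b : ℕ} (hb : b ≠ 0) (n : ℕ) :
    PowerSeries.coeff n (1 - PowerSeries.X ^ b : PowerSeries ℝ)⁻¹ ∈ Set.Icc (0 : ℝ) 1 := by
  induction n using Nat.strong_induction_on with
  | _ n ih =>
    rw [geom_eq hb, map_add, PowerSeries.coeff_X_pow_mul', PowerSeries.coeff_one]
    by_cases hn : n = 0
    · subst hn
      simp [hb]
    · rw [if_neg hn, zero_add]
      split_ifs
      · exact ih _ (by omega)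
      · simp

theorem coeff_geom_one (n : ℕ) :
    PowerSeries.coeff n (1 - PowerSeries.X ^ 1 : PowerSeries ℝ)⁻¹ = 1 := by
  induction n with
  | zero => rw [geom_eq one_ne_zero]; simp
  | succ n ih =>
    rw [geom_eq one_ne_zero, map_add, PowerSeries.coeff_X_pow_mul', PowerSeries.coeff_one]
    simpa using ih

theorem hasValue_geom {b : ℕ} (hb : b ≠ 0) {z : ℂ} (hz : ‖z‖ < 1) :
    HasValue (1 - PowerSeries.X ^ b : PowerSeries ℝ)⁻¹ z (1 - z ^ b)⁻¹ := by
  have hs : Summable (fun n => ‖((PowerSeries.coeff n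
      (1 - PowerSeries.X ^ b : PowerSeries ℝ)⁻¹ : ℝ) : ℂ) * z ^ n‖) := by
    refine (summable_geometric_of_lt_one (norm_nonneg z) hz).of_nonneg_of_le
      (fun _ => norm_nonneg _) fun n => ?_
    have := coeff_geom_mem_Icc hb n
    rw [norm_mul, norm_pow, Complex.norm_real, Real.norm_of_nonneg this.1]
    exact mul_le_of_le_one_left (by positivity) this.2
  refine ⟨hs, ?_⟩
  have h1 : HasValue (1 - PowerSeries.X ^ b) z (1 - z ^ b) := by
    simpa [sub_eq_add_neg] using (HasValue.one z).add (HasValue.X_pow b z).neg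
  -- The series is first given its own `tsum` as value; the product with 1 - X^b being 1 then
  -- identifies it.
  have h2 := h1.mul (HasValue.mk hs rfl)
  rw [PowerSeries.mul_inv_cancel _ (constantCoeff_one_sub_X_pow hb)] at h2
  have h3 := h2.tsum_eq.symm.trans (HasValue.one z).tsum_eq
  exact eq_inv_of_mul_eq_one_right h3

/-- The `n`-th factor of the products. -/
def factor (a : ℕ → ℕ) (n : ℕ) : PowerSeries ℝ :=
  ((1 + PowerSeries.X ^ a n) * (1 - PowerSeries.X ^ (2 * n + 1) : PowerSeries ℝ)⁻¹) ^ 16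

/-- The `n`-th factor of the products, as a function. -/
def factorFun (a : ℕ → ℕ) (n : ℕ) (z : ℂ) : ℂ :=
  ((1 + z ^ a n) * (1 - z ^ (2 * n + 1))⁻¹) ^ 16

theorem hasValue_factor (a : ℕ → ℕ) (n : ℕ) {z : ℂ} (hz : ‖z‖ < 1) :
    HasValue (factor a n) z (factorFun a n z) :=
  (((HasValue.one z).add (HasValue.X_pow _ z)).mul
    (hasValue_geom (Nat.succ_ne_zero _) hz)).pow 16

theorem coeffNonneg_pow_sub_one {p : PowerSeries ℝ} (hp : CoeffNonneg (p - 1)) (n : ℕ) :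
    CoeffNonneg (p ^ n - 1) := by
  induction n with
  | zero => intro n; simp
  | succ n ih =>
    have : p ^ (n + 1) - 1 = (p ^ n - 1) * (p - 1) + (p ^ n - 1) + (p - 1) := by ring
    rw [this]
    exact ((ih.mul hp).add ih).add hp

theorem coeffNonneg_factor_base (a : ℕ → ℕ) (n : ℕ) :
    CoeffNonneg ((1 + PowerSeries.X ^ a n) *
      (1 - PowerSeries.X ^ (2 * n + 1) : PowerSeries ℝ)⁻¹ -
      (1 - PowerSeries.X ^ (2 * n + 1) : PowerSeries ℝ)⁻¹) := by
  have hg : CoeffNonneg (1 - PowerSeries.X ^ (2 * n + 1) : PowerSeries ℝ)⁻¹ :=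
    fun k => (coeff_geom_mem_Icc (Nat.succ_ne_zero _) k).1
  convert (CoeffNonneg.X_pow (a n)).mul hg using 1
  ring

theorem coeffNonneg_factor_base_sub_one (a : ℕ → ℕ) (n : ℕ) :
    CoeffNonneg ((1 + PowerSeries.X ^ a n) *
      (1 - PowerSeries.X ^ (2 * n + 1) : PowerSeries ℝ)⁻¹ - 1) := by
  have hg : CoeffNonneg (1 - PowerSeries.X ^ (2 * n + 1) : PowerSeries ℝ)⁻¹ :=
    fun k => (coeff_geom_mem_Icc (Nat.succ_ne_zero _) k).1
  convert (coeffNonneg_factor_base a n).add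
    ((CoeffNonneg.X_pow (2 * n + 1)).mul hg) using 1
  linear_combination geom_eq (b := 2 * n + 1) (Nat.succ_ne_zero _)

/-- Hence a further factor can only increase the coefficients of a partial product, and the infinite
product is approached coefficientwise from below. -/
theorem coeffNonneg_factor_sub_one (a : ℕ → ℕ) (n : ℕ) : CoeffNonneg (factor a n - 1) :=
  coeffNonneg_pow_sub_one (coeffNonneg_factor_base_sub_one a n) 16

theorem coeffNonneg_partialProd (a : ℕ → ℕ) (N : ℕ) :
    CoeffNonneg (∏ n ∈ range N, factor a n) := by
  induction N with
  | zero => simpa using CoeffNonneg.one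
  | succ N ih =>
    rw [Finset.prod_range_succ]
    convert (ih.mul (coeffNonneg_factor_sub_one a N)).add ih using 1
    ring

theorem monotone_coeff_partialProd (a : ℕ → ℕ) (k : ℕ) :
    Monotone fun N => PowerSeries.coeff k (∏ n ∈ range N, factor a n) := by
  refine monotone_nat_of_le_succ fun N => ?_
  have h := (coeffNonneg_partialProd a N).mul (coeffNonneg_factor_sub_one a N) k
  rw [mul_sub, mul_one, map_sub, ← Finset.prod_range_succ] at h
  linarith

/-- Coefficientwise p^16 ≥ p ≥ 1/(1 - X), and the last series has all coefficients 1. This is what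
keeps the radius of convergence from exceeding 1. -/
theorem one_le_coeff_factor_zero (a : ℕ → ℕ) (k : ℕ) :
    1 ≤ PowerSeries.coeff k (∏ n ∈ range 1, factor a n) := by
  rw [Finset.prod_range_one]
  set p := (1 + PowerSeries.X ^ a 0) *
      (1 - PowerSeries.X ^ (2 * 0 + 1) : PowerSeries ℝ)⁻¹ with hp
  have h1 : CoeffNonneg (p - 1) := coeffNonneg_factor_base_sub_one a 0
  have h0 : CoeffNonneg p := by simpa using h1.add CoeffNonneg.one
  have h2 := (coeffNonneg_pow_sub_one h1 15).mul h0 k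
  have e : (p ^ 15 - 1) * p = factor a 0 - p := by
    rw [factor, ← hp]
    ring
  have h3 := coeffNonneg_factor_base a 0 k
  have h4 := coeff_geom_one k
  rw [e, map_sub] at h2
  rw [← hp, map_sub] at h3
  simp only [mul_zero, zero_add] at h3
  linarith

open scoped PowerSeries.WithPiTopology in
/-- The infinite product of the factors. -/
def factorProd (a : ℕ → ℕ) : PowerSeries ℝ := ∏' n, factor a n

open scoped PowerSeries.WithPiTopology in
theorem tendsto_coeff_partialProd {a : ℕ → ℕ} (ha : ∀ n, n < a n) (k : ℕ) :
    Tendsto (fun N => PowerSeries.coeff k (∏ n ∈ range N, factor a n)) atTop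
      (𝓝 (PowerSeries.coeff k (factorProd a))) := by
  have hm : Multipliable (factor a) :=
    multipliable_factors a (fun n => 2 * n + 1) ha (fun n => by omega)
  exact ((PowerSeries.WithPiTopology.continuous_coeff ℝ k).tendsto _).comp
    hm.hasProd.tendsto_prod_nat

theorem coeff_partialProd_le {a : ℕ → ℕ} (ha : ∀ n, n < a n) (k N : ℕ) :
    PowerSeries.coeff k (∏ n ∈ range N, factor a n) ≤ PowerSeries.coeff k (factorProd a) :=
  (monotone_coeff_partialProd a k).ge_of_tendsto (tendsto_coeff_partialProd ha k) N

theorem one_le_coeff_factorProd {a : ℕ → ℕ} (ha : ∀ n, n < a n) (k : ℕ) :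
    1 ≤ PowerSeries.coeff k (factorProd a) :=
  (one_le_coeff_factor_zero a k).trans (coeff_partialProd_le ha k 1)

/-- If the partial products of the factors converge at `|z|` and at `z`, then the power series
of the infinite product converges absolutely at `z` to the limit. -/
theorem hasValue_factorProd {a : ℕ → ℕ} (ha : ∀ n, n < a n) {z l v : ℂ} (hz : ‖z‖ < 1)
    (hl : Tendsto (fun N => ∏ n ∈ range N, factorFun a n (‖z‖ : ℂ)) atTop (𝓝 l))
    (hv : Tendsto (fun N => ∏ n ∈ range N, factorFun a n z) atTop (𝓝 v)) :
    HasValue (factorProd a) z v := by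
  have hf0 : CoeffNonneg (factorProd a) := fun k =>
    zero_le_one.trans (one_le_coeff_factorProd ha k)
  have hz' : ‖((‖z‖ : ℝ) : ℂ)‖ < 1 := by simpa using hz
  have hsum : Summable fun n => PowerSeries.coeff n (factorProd a) * ‖z‖ ^ n := by
    -- A finite sum for the infinite product is the limit of the same sums for partial products, and
    -- these are at most the values of the partial products at |z|, a bounded sequence.
    obtain ⟨K, hK⟩ := hl.norm.bddAbove_range
    refine summable_of_sum_le (c := K) (fun n => mul_nonneg (hf0 n) (by positivity)) fun s => ?_
    refine le_of_tendsto (tendsto_finsetSum s fun k _ =>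
      (tendsto_coeff_partialProd ha k).mul_const (‖z‖ ^ k)) (Eventually.of_forall fun N => ?_)
    have hN := HasValue.prod (range N) fun n => hasValue_factor a n hz'
    refine le_trans ?_ (hK ⟨N, rfl⟩)
    have hs : HasSum (fun n => PowerSeries.coeff n (∏ n ∈ range N, factor a n) * ‖z‖ ^ n)
        (∏ n ∈ range N, factorFun a n (‖z‖ : ℂ)).re := by
      have := Complex.hasSum_re hN.hasSum
      convert this using 2 with n
      rw [← Complex.ofReal_pow, ← Complex.ofReal_mul, Complex.ofReal_re]
    exact (sum_le_hasSum s (fun n _ => mul_nonneg (coeffNonneg_partialProd a N n)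
      (by positivity)) hs).trans (Complex.re_le_norm _)
  have hnorm : ∀ n, ‖((PowerSeries.coeff n (factorProd a) : ℝ) : ℂ) * z ^ n‖ =
      PowerSeries.coeff n (factorProd a) * ‖z‖ ^ n := fun n => by
    rw [norm_mul, norm_pow, Complex.norm_real, Real.norm_of_nonneg (hf0 n)]
  refine ⟨by simpa only [hnorm] using hsum, ?_⟩
  have htend : Tendsto (fun N => ∑' k,
      ((PowerSeries.coeff k (∏ n ∈ range N, factor a n) : ℝ) : ℂ) * z ^ k) atTop
      (𝓝 (∑' k, ((PowerSeries.coeff k (factorProd a) : ℝ) : ℂ) * z ^ k)) := by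
    -- Tannery's theorem: the coefficients of the limit dominate those of every partial product.
    refine tendsto_tsum_of_dominated_convergence hsum (fun k => ?_)
      (Eventually.of_forall fun N k => ?_)
    · exact ((Complex.continuous_ofReal.tendsto _).comp
        (tendsto_coeff_partialProd ha k)).mul_const _
    · rw [norm_mul, norm_pow, Complex.norm_real,
        Real.norm_of_nonneg (coeffNonneg_partialProd a N k)]
      exact mul_le_mul_of_nonneg_right (coeff_partialProd_le ha k N) (by positivity)
  refine tendsto_nhds_unique (htend.congr fun N => ?_) hv
  exact (HasValue.prod (range N) fun n => hasValue_factor a n hz).tsum_eq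

/-- A power series which converges in the open unit disc and whose coefficients are eventually
at least one has radius of convergence one. -/
theorem radius_eq_one {F : PowerSeries ℝ} {k : ℕ} (hF : ∀ n, 1 ≤ PowerSeries.coeff (n + k) F)
    (hs : ∀ r : ℝ, 0 < r → r < 1 → Summable fun n => ‖PowerSeries.coeff n F‖ * r ^ n) :
    radius F = 1 := by
  refine le_antisymm (le_of_not_gt fun h => ?_) (le_of_forall_lt fun r hr => ?_)
  · have h1 := FormalMultilinearSeries.summable_norm_mul_pow _ (r := 1)
      (by simpa [radius] using h)
    simp only [FormalMultilinearSeries.ofScalars_norm, NNReal.coe_one, one_pow, mul_one] at h1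
    have h2 := (h1.tendsto_atTop_zero.comp (tendsto_add_atTop_nat k))
    have h3 : (1 : ℝ) ≤ 0 := ge_of_tendsto' h2 fun n =>
      (hF n).trans (Real.le_norm_self _)
    norm_num at h3
  · obtain ⟨q, hq1, hq2⟩ := ENNReal.lt_iff_exists_nnreal_btwn.mp hr
    refine hq1.trans_le (FormalMultilinearSeries.le_radius_of_summable _ ?_)
    simp only [FormalMultilinearSeries.ofScalars_norm]
    have hq0 : (0 : ℝ) < q := by
      have : (0 : ENNReal) < q := bot_le.trans_lt hq1
      exact_mod_cast this
    exact hs q hq0 (by exact_mod_cast hq2)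

/-- Half of the exponential absorbs the power, by y^p ≤ p! exp(y) at y = xs/2; the other half is
kept for summation. -/
theorem pow_mul_exp_neg_le (p : ℕ) {x s : ℝ} (hx : 0 ≤ x) (hs : 0 < s) :
    x ^ p * Real.exp (-(x * s)) ≤ p ! * (2 / s) ^ p * Real.exp (-(x * (s / 2))) := by
  have h1 : (x * (s / 2)) ^ p ≤ p ! * Real.exp (x * (s / 2)) := by
    have := Real.pow_div_factorial_le_exp (x * (s / 2)) (by positivity) p
    rwa [div_le_iff₀ (by positivity), mul_comm (Real.exp _)] at this
  have h2 : x ^ p = (2 / s) ^ p * (x * (s / 2)) ^ p := by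
    rw [← mul_pow]
    congr 1
    field_simp
  have h3 : Real.exp (-(x * s)) = Real.exp (-(x * (s / 2))) * Real.exp (-(x * (s / 2))) := by
    rw [← Real.exp_add]
    ring_nf
  have h4 : Real.exp (x * (s / 2)) * Real.exp (-(x * (s / 2))) = 1 := by
    rw [← Real.exp_add]
    simp
  rw [h2, h3]
  calc (2 / s) ^ p * (x * (s / 2)) ^ p *
        (Real.exp (-(x * (s / 2))) * Real.exp (-(x * (s / 2))))
      ≤ (2 / s) ^ p * (p ! * Real.exp (x * (s / 2))) *
        (Real.exp (-(x * (s / 2))) * Real.exp (-(x * (s / 2)))) := by gcongr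
    _ = p ! * (2 / s) ^ p * Real.exp (-(x * (s / 2))) := by
      linear_combination (2 / s) ^ p * p ! * Real.exp (-(x * (s / 2))) * h4

/-! ### Dirichlet series and termwise differentiation -/

section ExpSum

variable {ι : Type*} {c : ι → ℝ} {e : ι → ℕ}

/-- The Dirichlet series `∑ cᵢ exp(-eᵢ s)`. -/
def expSum (c : ι → ℝ) (e : ι → ℕ) (s : ℝ) : ℝ := ∑' i, c i * Real.exp (-(e i * s))

/-- The Dirichlet series `∑ cᵢ exp(-eᵢ s)` converges absolutely for all `s > 0`. -/
def Admissible (c : ι → ℝ) (e : ι → ℕ) : Prop :=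
  ∀ s : ℝ, 0 < s → Summable fun i => |c i| * Real.exp (-(e i * s))

theorem Admissible.mul_pow (h : Admissible c e) (p : ℕ) :
    Admissible (fun i => c i * (e i : ℝ) ^ p) e := fun s hs => by
  refine ((h (s / 2) (half_pos hs)).mul_left (p ! * (2 / s) ^ p)).of_nonneg_of_le
    (fun i => by positivity) fun i => ?_
  have := mul_le_mul_of_nonneg_left (pow_mul_exp_neg_le p (Nat.cast_nonneg (e i)) hs)
    (abs_nonneg (c i))
  rw [abs_mul, abs_of_nonneg (a := (e i : ℝ) ^ p) (by positivity)]
  linarith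

theorem Admissible.mul_cast (h : Admissible c e) :
    Admissible (fun i => c i * (e i : ℝ)) e := by
  simpa using h.mul_pow 1

theorem Admissible.summable (h : Admissible c e) {s : ℝ} (hs : 0 < s) :
    Summable fun i => c i * Real.exp (-(e i * s)) :=
  Summable.of_norm (by simpa [abs_mul] using h s hs)

/-- On (s/2, ∞) the differentiated series is dominated by its absolute values at s/2. -/
theorem Admissible.hasDerivAt (h : Admissible c e) {s : ℝ} (hs : 0 < s) :
    HasDerivAt (expSum c e) (-expSum (fun i => c i * (e i : ℝ)) e s) s := by
  have key := hasDerivAt_tsum_of_isPreconnected (𝕜 := ℝ) (F := ℝ)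
    (g := fun i y => c i * Real.exp (-(e i * y)))
    (g' := fun i y => -(c i * e i * Real.exp (-(e i * y))))
    (u := fun i => |c i * e i| * Real.exp (-(e i * (s / 2)))) (t := Set.Ioi (s / 2))
    (y₀ := s) (y := s) (h.mul_cast (s / 2) (half_pos hs)) isOpen_Ioi isPreconnected_Ioi
    (fun i y _ => ?_) (fun i y hy => ?_) (half_lt_self hs) (h.summable hs) (half_lt_self hs)
  · rw [tsum_neg] at key
    exact key
  · have : HasDerivAt (fun y => c i * Real.exp (-(e i * y)))
        (c i * (Real.exp (-(e i * y)) * -(e i * 1))) y :=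
      ((hasDerivAt_id y).const_mul (e i : ℝ)).fun_neg.exp.const_mul (c i)
    exact this.congr_deriv (by ring)
  · rw [norm_neg, norm_mul, Real.norm_eq_abs, Real.norm_of_nonneg (Real.exp_pos _).le]
    have hy' : s / 2 ≤ y := le_of_lt hy
    gcongr

end ExpSum

/-! ### Mean and variance as logarithmic derivatives -/

section Moments

variable {F : PowerSeries ℝ} {Λ M V : ℝ → ℝ}

theorem value_exp_neg (F : PowerSeries ℝ) (s : ℝ) :
    value F (Real.exp (-s)) = expSum (fun n => PowerSeries.coeff n F) id s := by
  simp only [value, expSum, ← Real.exp_nat_mul, id]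
  congr! 4
  ring

theorem prob_exp_neg (F : PowerSeries ℝ) (s : ℝ) (n : ℕ) :
    prob F (Real.exp (-s)) n =
      PowerSeries.coeff n F * Real.exp (-(n * s)) / value F (Real.exp (-s)) := by
  rw [prob, ← Real.exp_nat_mul]
  congr! 3
  ring

/-- The first moment of `X_t`, `t = exp(-s)`, through the logarithm `Λ` of the power series. -/
theorem expSum_one_eq (hF : Admissible (fun n => PowerSeries.coeff n F) id)
    (hΛ : ∀ s, 0 < s → value F (Real.exp (-s)) = Real.exp (Λ s))
    (hM : ∀ s, 0 < s → HasDerivAt Λ (-M s) s) {s : ℝ} (hs : 0 < s) :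
    expSum (fun n => PowerSeries.coeff n F * ((id n : ℕ) : ℝ)) id s =
      M s * Real.exp (Λ s) := by
  have h1 := hF.hasDerivAt hs
  have h2 := (hM s hs).exp
  have h3 : expSum (fun n => PowerSeries.coeff n F) id =ᶠ[𝓝 s] fun y => Real.exp (Λ y) := by
    filter_upwards [lt_mem_nhds hs] with y hy
    rw [← value_exp_neg, hΛ y hy]
  have := h1.unique (h2.congr_of_eventuallyEq h3)
  linarith

/-- The derivative of the first moment M exp(Λ) is -(V + M²) exp(Λ); the M² disappears on centring.
-/
theorem expSum_two_eq (hF : Admissible (fun n => PowerSeries.coeff n F) id)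
    (hΛ : ∀ s, 0 < s → value F (Real.exp (-s)) = Real.exp (Λ s))
    (hM : ∀ s, 0 < s → HasDerivAt Λ (-M s) s) (hV : ∀ s, 0 < s → HasDerivAt M (-V s) s)
    {s : ℝ} (hs : 0 < s) :
    expSum (fun n => PowerSeries.coeff n F * ((id n : ℕ) : ℝ) * ((id n : ℕ) : ℝ)) id s =
      (V s + M s ^ 2) * Real.exp (Λ s) := by
  have h1 := hF.mul_cast.hasDerivAt hs
  have h2 := (hV s hs).mul (hM s hs).exp
  have h3 : expSum (fun n => PowerSeries.coeff n F * ((id n : ℕ) : ℝ)) id =ᶠ[𝓝 s]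
      M * fun y => Real.exp (Λ y) := by
    filter_upwards [lt_mem_nhds hs] with y hy
    rw [expSum_one_eq hF hΛ hM hy]
    rfl
  have := h1.unique (h2.congr_of_eventuallyEq h3)
  linear_combination -this

theorem mean_exp_neg (hF : Admissible (fun n => PowerSeries.coeff n F) id)
    (hΛ : ∀ s, 0 < s → value F (Real.exp (-s)) = Real.exp (Λ s))
    (hM : ∀ s, 0 < s → HasDerivAt Λ (-M s) s) {s : ℝ} (hs : 0 < s) :
    mean F (Real.exp (-s)) = M s := by
  have h := expSum_one_eq hF hΛ hM hs
  have hpos := Real.exp_pos (Λ s)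
  rw [mean, expect]
  have : ∀ n : ℕ, prob F (Real.exp (-s)) n • (n : ℝ) =
      PowerSeries.coeff n F * ((id n : ℕ) : ℝ) * Real.exp (-((id n : ℕ) * s)) /
        Real.exp (Λ s) := by
    intro n
    rw [prob_exp_neg, hΛ s hs, smul_eq_mul, id]
    ring
  simp_rw [this]
  rw [tsum_div_const]
  change expSum _ _ _ / _ = _
  rw [h]
  field_simp

theorem variance_exp_neg (hF : Admissible (fun n => PowerSeries.coeff n F) id)
    (hΛ : ∀ s, 0 < s → value F (Real.exp (-s)) = Real.exp (Λ s))
    (hM : ∀ s, 0 < s → HasDerivAt Λ (-M s) s) (hV : ∀ s, 0 < s → HasDerivAt M (-V s) s)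
    {s : ℝ} (hs : 0 < s) : variance F (Real.exp (-s)) = V s := by
  have h0 : expSum (fun n => PowerSeries.coeff n F) id s = Real.exp (Λ s) := by
    rw [← value_exp_neg, hΛ s hs]
  have h1 := expSum_one_eq hF hΛ hM hs
  have h2 := expSum_two_eq hF hΛ hM hV hs
  have hpos := Real.exp_pos (Λ s)
  have s0 := (hF.summable hs).hasSum
  have s1 := (hF.mul_cast.summable hs).hasSum
  have s2 := (hF.mul_cast.mul_cast.summable hs).hasSum
  rw [show (∑' n, _) = Real.exp (Λ s) from h0] at s0
  rw [show (∑' n, _) = _ from h1] at s1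
  rw [show (∑' n, _) = _ from h2] at s2
  rw [variance, expect, mean_exp_neg hF hΛ hM hs]
  have key := (((s2.sub (s1.mul_left (2 * M s))).add (s0.mul_left (M s ^ 2))).div_const
    (Real.exp (Λ s))).tsum_eq
  have e : (V s + M s ^ 2) * Real.exp (Λ s) - 2 * M s * (M s * Real.exp (Λ s)) +
      M s ^ 2 * Real.exp (Λ s) = V s * Real.exp (Λ s) := by ring
  rw [e, mul_div_cancel_right₀ _ hpos.ne'] at key
  rw [← key]
  refine tsum_congr fun n => ?_
  rw [prob_exp_neg, hΛ s hs, smul_eq_mul, id]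
  ring

end Moments

/-! ### Size of the double series as s → 0 -/

section DoubleSum

/-- With r = exp(-ks), the geometric sum r/(1 - r) is at most 1/(ks), because exp(ks) ≥ 1 + ks. The
coefficient 1/k supplies the second factor that makes the sum over k converge. -/
theorem hasSum_harmonic_exp {s : ℝ} (hs : 0 < s) (k : ℕ) :
    ∃ v, HasSum (fun n : ℕ => 1 / (k : ℝ) * Real.exp (-((n + 1) * k * s))) v ∧
      v ≤ 1 / (k : ℝ) ^ 2 / s := by
  -- At k = 0 the convention 1/0 = 0 removes the term that the logarithmic series does not have.
  rcases Nat.eq_zero_or_pos k with rfl | hk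
  · exact ⟨0, by simp, by simp⟩
  have hk' : (0 : ℝ) < k := by exact_mod_cast hk
  have hy : 0 < (k : ℝ) * s := by positivity
  set r := Real.exp (-(k * s)) with hr
  have hr1 : r < 1 := by rw [hr, Real.exp_lt_one_iff]; linarith
  have hr0 : 0 < r := Real.exp_pos _
  refine ⟨1 / (k : ℝ) * ((1 - r)⁻¹ * r), ?_, ?_⟩
  · have := ((hasSum_geometric_of_lt_one hr0.le hr1).mul_right r).mul_left (1 / (k : ℝ))
    refine this.congr_fun fun n => ?_
    rw [← pow_succ, hr, ← Real.exp_nat_mul]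
    push_cast
    ring_nf
  · have h1 : r * (1 + k * s) ≤ 1 := by
      have h := Real.add_one_le_exp ((k : ℝ) * s)
      have h' : r * Real.exp (k * s) = 1 := by rw [hr, ← Real.exp_add]; simp
      nlinarith
    have h2 : (1 - r)⁻¹ * r ≤ 1 / (k * s) := by
      rw [inv_mul_eq_div, div_le_div_iff₀ (by linarith) hy]
      linarith
    calc 1 / (k : ℝ) * ((1 - r)⁻¹ * r) ≤ 1 / (k : ℝ) * (1 / (k * s)) := by gcongr
      _ = 1 / (k : ℝ) ^ 2 / s := by field_simp

theorem harmonic_exp_double_sum {s : ℝ} (hs : 0 < s) :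
    (Summable fun i : ℕ × ℕ => 1 / (i.2 : ℝ) * Real.exp (-((i.1 + 1) * i.2 * s))) ∧
    ∑' i : ℕ × ℕ, 1 / (i.2 : ℝ) * Real.exp (-((i.1 + 1) * i.2 * s)) ≤
      (∑' k : ℕ, 1 / (k : ℝ) ^ 2) / s := by
  choose v hv hv' using hasSum_harmonic_exp hs
  have hv0 : ∀ k, 0 ≤ v k := fun k => (hv k).nonneg fun n => by positivity
  have hS : Summable fun k : ℕ => 1 / (k : ℝ) ^ 2 / s :=
    (Real.summable_one_div_nat_pow.mpr one_lt_two).div_const s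
  have hvS : Summable v := hS.of_nonneg_of_le hv0 hv'
  -- The coordinates are swapped so that the geometric sum over n is the inner one.
  let f : ℕ × ℕ → ℝ := fun i => 1 / (i.1 : ℝ) * Real.exp (-((i.2 + 1) * i.1 * s))
  have hf : Summable f := by
    refine (summable_prod_of_nonneg fun i => by simp only [f, Pi.zero_apply]; positivity).mpr
      ⟨fun k => (hv k).summable, ?_⟩
    exact hvS.congr fun k => (hv k).tsum_eq.symm
  have e : (fun i : ℕ × ℕ => 1 / (i.2 : ℝ) * Real.exp (-((i.1 + 1) * i.2 * s))) =
      f ∘ Equiv.prodComm ℕ ℕ := rfl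
  constructor
  · rw [e]
    exact (Equiv.prodComm ℕ ℕ).summable_iff.mpr hf
  · rw [e, show (∑' i, (f ∘ Equiv.prodComm ℕ ℕ) i) = ∑' i, f i from
      (Equiv.prodComm ℕ ℕ).tsum_eq f, hf.tsum_prod, ← tsum_div_const]
    exact Summable.tsum_le_tsum (fun k => (hv k).tsum_eq.le.trans (hv' k))
      (hvS.congr fun k => (hv k).tsum_eq.symm) hS

/-- The exponents in the logarithm of the products. -/
def logExp (a : ℕ → ℕ) (i : ℕ × ℕ) : ℕ := a i.1 * i.2

variable {a : ℕ → ℕ} {c : ℕ × ℕ → ℝ}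

theorem logTerm_le (ha : ∀ n, n < a n) (hc : ∀ i, |c i| ≤ 16 * (1 / (i.2 : ℝ))) (p : ℕ)
    {s : ℝ} (hs : 0 < s) (i : ℕ × ℕ) :
    |c i| * (logExp a i : ℝ) ^ p * Real.exp (-(logExp a i * s)) ≤
      16 * (p ! * (2 / s) ^ p) *
        (1 / (i.2 : ℝ) * Real.exp (-((i.1 + 1) * i.2 * (s / 2)))) := by
  have h1 := pow_mul_exp_neg_le p (Nat.cast_nonneg (logExp a i)) hs
  have h2 : ((i.1 : ℝ) + 1) * i.2 ≤ (logExp a i : ℝ) := by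
    rw [logExp]
    exact_mod_cast Nat.mul_le_mul_right _ (ha i.1)
  calc |c i| * (logExp a i : ℝ) ^ p * Real.exp (-(logExp a i * s))
      = |c i| * ((logExp a i : ℝ) ^ p * Real.exp (-(logExp a i * s))) := by ring
    _ ≤ (16 * (1 / (i.2 : ℝ))) * (p ! * (2 / s) ^ p *
          Real.exp (-((i.1 + 1) * i.2 * (s / 2)))) := by
        refine mul_le_mul (hc i) (h1.trans ?_) (by positivity) (by positivity)
        gcongr
    _ = _ := by ring

theorem summable_logTerm (ha : ∀ n, n < a n) (hc : ∀ i, |c i| ≤ 16 * (1 / (i.2 : ℝ))) (p : ℕ)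
    {s : ℝ} (hs : 0 < s) :
    Summable fun i => |c i| * (logExp a i : ℝ) ^ p * Real.exp (-(logExp a i * s)) :=
  ((harmonic_exp_double_sum (half_pos hs)).1.mul_left _).of_nonneg_of_le
    (fun i => by positivity) (logTerm_le ha hc p hs)

theorem admissible_logTerm (ha : ∀ n, n < a n) (hc : ∀ i, |c i| ≤ 16 * (1 / (i.2 : ℝ))) :
    Admissible c (logExp a) := fun s hs => by
  simpa using summable_logTerm ha hc 0 hs

/-- Each power of the exponent costs a factor 1/s. The case p = 2 bounds the variance, p = 3 the
Taylor remainder. -/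
theorem tsum_logTerm_le (ha : ∀ n, n < a n) (hc : ∀ i, |c i| ≤ 16 * (1 / (i.2 : ℝ))) (p : ℕ)
    {s : ℝ} (hs : 0 < s) :
    ∑' i, |c i| * (logExp a i : ℝ) ^ p * Real.exp (-(logExp a i * s)) ≤
      16 * (p ! * 2 ^ (p + 1)) * (∑' k : ℕ, 1 / (k : ℝ) ^ 2) / s ^ (p + 1) := by
  have h := harmonic_exp_double_sum (half_pos hs)
  calc _ ≤ _ := Summable.tsum_le_tsum (logTerm_le ha hc p hs) (summable_logTerm ha hc p hs)
          (h.1.mul_left _)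
    _ = _ := tsum_mul_left
    _ ≤ 16 * (p ! * (2 / s) ^ p) * ((∑' k : ℕ, 1 / (k : ℝ) ^ 2) / (s / 2)) := by
      gcongr
      exact h.2
    _ = _ := by
      rw [div_pow, pow_succ, pow_succ]
      field_simp

end DoubleSum

/-! ### Logarithmic series and their expansion along a circle -/

/-- The coefficients of `-16 log(1 - x)`. -/
def posCoeff (i : ℕ × ℕ) : ℝ := 16 * (1 / (i.2 : ℝ))

/-- The coefficients of `16 log(1 + x)`. -/
def altCoeff (i : ℕ × ℕ) : ℝ := 16 * ((-1) ^ (i.2 + 1) / (i.2 : ℝ))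

theorem abs_posCoeff_le (i : ℕ × ℕ) : |posCoeff i| ≤ 16 * (1 / (i.2 : ℝ)) := by
  rw [posCoeff, abs_of_nonneg (by positivity)]

theorem abs_altCoeff_le (i : ℕ × ℕ) : |altCoeff i| ≤ 16 * (1 / (i.2 : ℝ)) := by
  rw [altCoeff, abs_mul, abs_div, abs_pow]
  simp

/-- The odd numbers. -/
def oddSeq (n : ℕ) : ℕ := 2 * n + 1

theorem lt_oddSeq (n : ℕ) : n < oddSeq n := by
  rw [oddSeq]
  omega

/-- The series `∑ cᵢ z^(eᵢ)`. -/
def powSum {ι : Type*} (c : ι → ℝ) (e : ι → ℕ) (z : ℂ) : ℂ := ∑' i, (c i : ℂ) * z ^ e i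

section PowSum

variable {ι : Type*} {c : ι → ℝ} {e : ι → ℕ}

theorem Admissible.summable_powSum (h : Admissible c e) {z : ℂ} {s : ℝ} (hs : 0 < s)
    (hz : ‖z‖ = Real.exp (-s)) : Summable fun i => (c i : ℂ) * z ^ e i := by
  refine Summable.of_norm ((h s hs).congr fun i => ?_)
  rw [norm_mul, norm_pow, hz, Complex.norm_real, Real.norm_eq_abs, ← Real.exp_nat_mul]
  ring_nf

theorem powSum_ofReal_exp (c : ι → ℝ) (e : ι → ℕ) (s : ℝ) :
    powSum c e (Real.exp (-s) : ℝ) = (expSum c e s : ℝ) := by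
  rw [powSum, expSum, Complex.ofReal_tsum]
  refine tsum_congr fun i => ?_
  rw [← Complex.ofReal_pow, ← Complex.ofReal_mul, ← Real.exp_nat_mul]
  ring_nf

/-- For |x| ≤ 1 this is the remainder of the exponential series; for |x| ≥ 1 the four terms have
total size at most (1 + 1 + 1 + 1/2)|x|³. -/
theorem norm_exp_I_mul_sub_taylor_le (x : ℝ) :
    ‖Complex.exp (Complex.I * x) - 1 - Complex.I * x + (x : ℂ) ^ 2 / 2‖ ≤ 4 * |x| ^ 3 := by
  have hn : ‖Complex.I * (x : ℂ)‖ = |x| := by simp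
  rcases le_total |x| 1 with h | h
  · have h1 := Complex.exp_bound (x := Complex.I * x) (by rwa [hn]) (n := 3) (by norm_num)
    rw [hn] at h1
    have e : Complex.exp (Complex.I * x) - ∑ m ∈ range 3, (Complex.I * x) ^ m / (m ! : ℂ) =
        Complex.exp (Complex.I * x) - 1 - Complex.I * x + (x : ℂ) ^ 2 / 2 := by
      simp only [Finset.sum_range_succ, Finset.sum_range_zero, mul_pow, Complex.I_sq,
        Nat.factorial]
      push_cast
      ring
    rw [e] at h1
    refine h1.trans ?_
    rw [mul_comm]
    gcongr
    norm_num [Nat.factorial]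
  · have h0 : ‖Complex.exp (Complex.I * x)‖ = 1 := Complex.norm_exp_I_mul_ofReal x
    have h3 : ‖(x : ℂ) ^ 2 / 2‖ = |x| ^ 2 / 2 := by simp
    have h4 : |x| ≤ |x| ^ 3 := le_self_pow₀ h (by norm_num)
    have h5 : |x| ^ 2 ≤ |x| ^ 3 := pow_le_pow_right₀ h (by norm_num)
    calc _ ≤ ‖Complex.exp (Complex.I * x)‖ + ‖(1 : ℂ)‖ + ‖Complex.I * (x : ℂ)‖ +
          ‖(x : ℂ) ^ 2 / 2‖ :=
          (norm_add_le _ _).trans (add_le_add_left ((norm_sub_le _ _).trans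
            (add_le_add_left (norm_sub_le _ _) _)) _)
      _ ≤ _ := by
        rw [h0, hn, h3, norm_one]
        nlinarith

/-- Second order Taylor expansion of `∑ cᵢ z^(eᵢ)` along a circle. -/
theorem Admissible.norm_powSum_sub_taylor_le (h : Admissible c e) {s : ℝ} (hs : 0 < s) (ξ : ℝ) :
    ‖powSum c e (Complex.exp (-s + Complex.I * ξ)) - (expSum c e s : ℝ) -
      Complex.I * ξ * (expSum (fun i => c i * (e i : ℝ)) e s : ℝ) +
      (ξ : ℂ) ^ 2 / 2 * (expSum (fun i => c i * (e i : ℝ) * (e i : ℝ)) e s : ℝ)‖ ≤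
    4 * |ξ| ^ 3 * ∑' i, |c i| * (e i : ℝ) ^ 3 * Real.exp (-(e i * s)) := by
  have hz : ‖Complex.exp (-s + Complex.I * ξ)‖ = Real.exp (-s) := by
    rw [Complex.norm_exp]
    simp
  have s0 := (h.summable_powSum hs hz).hasSum
  have s1 := Complex.hasSum_ofReal.mpr (h.summable hs).hasSum
  have s2 := (Complex.hasSum_ofReal.mpr (h.mul_cast.summable hs).hasSum).mul_left
    (Complex.I * ξ)
  have s3 := (Complex.hasSum_ofReal.mpr (h.mul_cast.mul_cast.summable hs).hasSum).mul_left
    ((ξ : ℂ) ^ 2 / 2)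
  have hsum := (((s0.sub s1).sub s2).add s3).tsum_eq
  have hb : Summable fun i => |c i| * (e i : ℝ) ^ 3 * Real.exp (-(e i * s)) := by
    refine (h.mul_pow 3 s hs).congr fun i => ?_
    rw [abs_mul, abs_of_nonneg (a := (e i : ℝ) ^ 3) (by positivity)]
  change ‖(∑' i, _) - ((∑' i, _ : ℝ) : ℂ) - _ * ((∑' i, _ : ℝ) : ℂ) +
    _ * ((∑' i, _ : ℝ) : ℂ)‖ ≤ _
  rw [← hsum]
  refine tsum_of_norm_bounded (hb.hasSum.mul_left _) fun i => ?_
  have hx : Complex.exp (-s + Complex.I * ξ) ^ e i =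
      (Real.exp (-(e i * s)) : ℝ) * Complex.exp (Complex.I * ((e i * ξ : ℝ) : ℂ)) := by
    rw [← Complex.exp_nat_mul, Complex.ofReal_exp, ← Complex.exp_add]
    push_cast
    ring_nf
  have key : (c i : ℂ) * Complex.exp (-s + Complex.I * ξ) ^ e i -
      ((c i * Real.exp (-(e i * s)) : ℝ) : ℂ) -
      Complex.I * ξ * ((c i * e i * Real.exp (-(e i * s)) : ℝ) : ℂ) +
      (ξ : ℂ) ^ 2 / 2 * ((c i * e i * e i * Real.exp (-(e i * s)) : ℝ) : ℂ) =
      ((c i * Real.exp (-(e i * s)) : ℝ) : ℂ) * (Complex.exp (Complex.I * ((e i * ξ : ℝ) : ℂ)) -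
        1 - Complex.I * ((e i * ξ : ℝ) : ℂ) + ((e i * ξ : ℝ) : ℂ) ^ 2 / 2) := by
    rw [hx]
    push_cast
    ring
  rw [key, norm_mul, Complex.norm_real, Real.norm_eq_abs, abs_mul,
    abs_of_nonneg (Real.exp_pos _).le]
  have h3 := norm_exp_I_mul_sub_taylor_le (e i * ξ)
  rw [abs_mul, Nat.abs_cast] at h3
  calc _ ≤ |c i| * Real.exp (-(e i * s)) * (4 * (e i * |ξ|) ^ 3) := by gcongr
    _ = _ := by ring

end PowSum

/-- The logarithm of the product of the factors. -/
def logProd (a : ℕ → ℕ) (z : ℂ) : ℂ :=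
  powSum posCoeff (logExp oddSeq) z + powSum altCoeff (logExp a) z

theorem admissible_pos : Admissible posCoeff (logExp oddSeq) :=
  admissible_logTerm lt_oddSeq abs_posCoeff_le

theorem admissible_alt {a : ℕ → ℕ} (ha : ∀ n, n < a n) : Admissible altCoeff (logExp a) :=
  admissible_logTerm ha abs_altCoeff_le

/-- Summing over the inner index first gives 16 (log(1 + z^(a n)) - log(1 - z^(2n+1))). Only
exponentials of partial sums are compared, so the branch of the logarithm plays no role. -/
theorem tendsto_prod_factorFun {a : ℕ → ℕ} (ha : ∀ n, n < a n) {z : ℂ} {s : ℝ} (hs : 0 < s)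
    (hz : ‖z‖ = Real.exp (-s)) :
    Tendsto (fun N => ∏ n ∈ range N, factorFun a n z) atTop
      (𝓝 (Complex.exp (logProd a z))) := by
  have hz1 : ‖z‖ < 1 := by rw [hz, Real.exp_lt_one_iff]; linarith
  have hzp : ∀ m : ℕ, m ≠ 0 → ‖z ^ m‖ < 1 := fun m hm => by
    rw [norm_pow]
    exact pow_lt_one₀ (norm_nonneg _) hz1 hm
  have h1 : HasSum (fun n => 16 * -Complex.log (1 - z ^ oddSeq n))
      (powSum posCoeff (logExp oddSeq) z) := by
    refine (admissible_pos.summable_powSum hs hz).hasSum.prod_fiberwise fun n => ?_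
    refine ((Complex.hasSum_taylorSeries_neg_log
      (hzp (oddSeq n) (Nat.ne_zero_of_lt (lt_oddSeq n)))).mul_left 16).congr_fun fun k => ?_
    simp only [posCoeff, logExp]
    push_cast
    rw [pow_mul]
    ring
  have h2 : HasSum (fun n => 16 * Complex.log (1 + z ^ a n))
      (powSum altCoeff (logExp a) z) := by
    refine ((admissible_alt ha).summable_powSum hs hz).hasSum.prod_fiberwise fun n => ?_
    refine ((Complex.hasSum_taylorSeries_log
      (hzp (a n) (Nat.ne_zero_of_lt (ha n)))).mul_left 16).congr_fun fun k => ?_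
    simp only [altCoeff, logExp]
    push_cast
    rw [pow_mul]
    ring
  refine ((Complex.continuous_exp.tendsto _).comp (h1.add h2).tendsto_sum_nat).congr fun N => ?_
  rw [Function.comp_apply, Complex.exp_sum]
  refine Finset.prod_congr rfl fun n _ => ?_
  have e1 : 1 - z ^ oddSeq n ≠ 0 := by
    intro h0
    have := hzp (oddSeq n) (Nat.ne_zero_of_lt (lt_oddSeq n))
    rw [← sub_eq_zero.mp h0] at this
    simp at this
  have e2 : 1 + z ^ a n ≠ 0 := by
    intro h0
    have := hzp (a n) (Nat.ne_zero_of_lt (ha n))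
    rw [← neg_eq_of_add_eq_zero_right h0] at this
    simp at this
  have c16 : (16 : ℂ) = ((16 : ℕ) : ℂ) := by norm_num
  rw [Complex.exp_add, c16, Complex.exp_nat_mul, Complex.exp_nat_mul, Complex.exp_neg,
    Complex.exp_log e1, Complex.exp_log e2, factorFun, mul_comm, mul_pow]
  rfl

/-! ### The common form of the two series -/

/-- The power series `C Xᵏ ∏ₙ factor a n`. -/
def model (C : ℝ) (k : ℕ) (a : ℕ → ℕ) : PowerSeries ℝ :=
  PowerSeries.monomial k C * factorProd a

theorem hasValue_model {a : ℕ → ℕ} (ha : ∀ n, n < a n) (C : ℝ) (k : ℕ) {z : ℂ} {s : ℝ}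
    (hs : 0 < s) (hz : ‖z‖ = Real.exp (-s)) :
    HasValue (model C k a) z (C * z ^ k * Complex.exp (logProd a z)) := by
  have hz1 : ‖z‖ < 1 := by rw [hz, Real.exp_lt_one_iff]; linarith
  exact (HasValue.monomial k C z).mul (hasValue_factorProd ha hz1
    (tendsto_prod_factorFun ha hs (by simpa using hz)) (tendsto_prod_factorFun ha hs hz))

section Model

variable {C : ℝ} {k : ℕ} {a : ℕ → ℕ}

theorem coeff_model (n : ℕ) : PowerSeries.coeff n (model C k a) =
    if k ≤ n then C * PowerSeries.coeff (n - k) (factorProd a) else 0 := by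
  have : PowerSeries.monomial k C = PowerSeries.C C * PowerSeries.X ^ k := by
    rw [PowerSeries.monomial_eq_C_mul_X_pow]
  rw [model, this, mul_assoc, PowerSeries.coeff_C_mul, PowerSeries.coeff_X_pow_mul']
  split_ifs <;> simp

theorem coeffNonneg_model (ha : ∀ n, n < a n) (hC : 1 ≤ C) : CoeffNonneg (model C k a) :=
  fun n => by
    rw [coeff_model]
    split_ifs
    · exact mul_nonneg (by linarith) (zero_le_one.trans (one_le_coeff_factorProd ha _))
    · exact le_rfl

theorem one_le_coeff_model (ha : ∀ n, n < a n) (hC : 1 ≤ C) (n : ℕ) :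
    1 ≤ PowerSeries.coeff (n + k) (model C k a) := by
  rw [coeff_model, if_pos (by omega)]
  exact one_le_mul_of_one_le_of_one_le hC (one_le_coeff_factorProd ha _)

theorem admissible_model (ha : ∀ n, n < a n) :
    Admissible (fun n => PowerSeries.coeff n (model C k a)) id := fun s hs => by
  have hz : ‖((Real.exp (-s) : ℝ) : ℂ)‖ = Real.exp (-s) := by
    rw [Complex.norm_real, Real.norm_of_nonneg (Real.exp_pos _).le]
  refine (hasValue_model ha C k hs hz).summable.congr fun n => ?_
  rw [norm_mul, norm_pow, hz, Complex.norm_real, Real.norm_eq_abs, ← Real.exp_nat_mul, id]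
  ring_nf

theorem radius_model (ha : ∀ n, n < a n) (hC : 1 ≤ C) : radius (model C k a) = 1 := by
  refine radius_eq_one (one_le_coeff_model ha hC) fun r hr0 hr1 => ?_
  have hs : 0 < -Real.log r := by linarith [Real.log_neg hr0 hr1]
  refine (admissible_model (C := C) (k := k) ha _ hs).congr fun n => ?_
  have : Real.exp (-(((id n : ℕ) : ℝ) * -Real.log r)) = r ^ n := by
    rw [mul_neg, neg_neg, id, Real.exp_nat_mul, Real.exp_log hr0]
  rw [this, Real.norm_eq_abs]

/-- The logarithm of the value of the model at `exp(-s)`. -/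
def modelLog (C : ℝ) (k : ℕ) (a : ℕ → ℕ) (s : ℝ) : ℝ :=
  Real.log C - k * s + expSum posCoeff (logExp oddSeq) s + expSum altCoeff (logExp a) s

/-- The mean of the model at `exp(-s)`. -/
def modelMean (k : ℕ) (a : ℕ → ℕ) (s : ℝ) : ℝ :=
  k + expSum (fun i => posCoeff i * (logExp oddSeq i : ℝ)) (logExp oddSeq) s +
    expSum (fun i => altCoeff i * (logExp a i : ℝ)) (logExp a) s

/-- The variance of the model at `exp(-s)`. -/
def modelVar (a : ℕ → ℕ) (s : ℝ) : ℝ :=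
  expSum (fun i => posCoeff i * (logExp oddSeq i : ℝ) * (logExp oddSeq i : ℝ))
      (logExp oddSeq) s +
    expSum (fun i => altCoeff i * (logExp a i : ℝ) * (logExp a i : ℝ)) (logExp a) s

theorem value_model (ha : ∀ n, n < a n) (hC : 1 ≤ C) {s : ℝ} (hs : 0 < s) :
    value (model C k a) (Real.exp (-s)) = Real.exp (modelLog C k a s) := by
  have hz : ‖((Real.exp (-s) : ℝ) : ℂ)‖ = Real.exp (-s) := by
    rw [Complex.norm_real, Real.norm_of_nonneg (Real.exp_pos _).le]
  have h := (hasValue_model ha C k hs hz).tsum_eq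
  have e : (value (model C k a) (Real.exp (-s)) : ℂ) =
      ∑' n, ((PowerSeries.coeff n (model C k a) : ℝ) : ℂ) * ((Real.exp (-s) : ℝ) : ℂ) ^ n := by
    rw [value, Complex.ofReal_tsum]
    push_cast
    rfl
  apply Complex.ofReal_injective
  rw [e, h, logProd, powSum_ofReal_exp, powSum_ofReal_exp, ← Complex.ofReal_add,
    ← Complex.ofReal_exp, ← Complex.ofReal_pow, ← Complex.ofReal_mul, ← Complex.ofReal_mul]
  congr 1
  rw [modelLog, sub_eq_add_neg, add_assoc, Real.exp_add (_ + _), Real.exp_add (Real.log C),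
    Real.exp_log (by linarith), ← Real.exp_nat_mul, mul_neg]

theorem hasDerivAt_modelLog (ha : ∀ n, n < a n) {s : ℝ} (hs : 0 < s) :
    HasDerivAt (modelLog C k a) (-modelMean k a s) s := by
  have h1 := admissible_pos.hasDerivAt hs
  have h2 := (admissible_alt ha).hasDerivAt hs
  have h3 : HasDerivAt (fun s : ℝ => Real.log C - k * s) (-(k * 1)) s :=
    ((hasDerivAt_id s).const_mul (k : ℝ)).const_sub _
  refine ((h3.add h1).add h2).congr_deriv ?_
  rw [modelMean]
  ring

theorem hasDerivAt_modelMean (ha : ∀ n, n < a n) {s : ℝ} (hs : 0 < s) :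
    HasDerivAt (modelMean k a) (-modelVar a s) s := by
  have h1 := admissible_pos.mul_cast.hasDerivAt hs
  have h2 := (admissible_alt ha).mul_cast.hasDerivAt hs
  refine ((h1.const_add (k : ℝ)).add h2).congr_deriv ?_
  rw [modelVar]
  ring

theorem mean_model (ha : ∀ n, n < a n) (hC : 1 ≤ C) {s : ℝ} (hs : 0 < s) :
    mean (model C k a) (Real.exp (-s)) = modelMean k a s :=
  mean_exp_neg (admissible_model ha) (fun _ => value_model ha hC)
    (fun _ => hasDerivAt_modelLog ha) hs

theorem variance_model (ha : ∀ n, n < a n) (hC : 1 ≤ C) {s : ℝ} (hs : 0 < s) :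
    variance (model C k a) (Real.exp (-s)) = modelVar a s :=
  variance_exp_neg (admissible_model ha) (fun _ => value_model ha hC)
    (fun _ => hasDerivAt_modelLog ha) (fun _ => hasDerivAt_modelMean ha) hs

/-- This is exp(-iξm) F(t exp(iξ)) / F(t) with ξ = θ/σ: the constant C cancels and the monomial
leaves exp(iξk). -/
theorem charFunZ_model (ha : ∀ n, n < a n) (hC : 1 ≤ C) {s : ℝ} (hs : 0 < s) (θ : ℝ) :
    charFunZ (model C k a) (Real.exp (-s)) θ =
      Complex.exp (Complex.I * ((θ / √(modelVar a s) : ℝ) : ℂ) * (k - modelMean k a s)) *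
      Complex.exp (logProd a (Complex.exp (-s + Complex.I * ((θ / √(modelVar a s) : ℝ) : ℂ))) -
        logProd a (Real.exp (-s) : ℝ)) := by
  set ξ : ℝ := θ / √(modelVar a s) with hξ
  have hz : ‖Complex.exp (-s + Complex.I * ξ)‖ = Real.exp (-s) := by
    rw [Complex.norm_exp]
    simp
  have h := (hasValue_model ha C k hs hz).tsum_eq
  have hC0 : (C : ℂ) ≠ 0 := by
    have : C ≠ 0 := by linarith
    exact_mod_cast this
  have hval : (value (model C k a) (Real.exp (-s)) : ℂ) =
      C * Complex.exp (-(k * s)) * Complex.exp (logProd a (Real.exp (-s) : ℝ)) := by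
    rw [value_model ha hC hs, modelLog, logProd, powSum_ofReal_exp, powSum_ofReal_exp,
      sub_eq_add_neg, add_assoc, Real.exp_add (_ + _), Real.exp_add (Real.log C),
      Real.exp_log (by linarith)]
    push_cast
    rfl
  have key : ∀ n : ℕ, prob (model C k a) (Real.exp (-s)) n • Complex.exp (Complex.I *
      ((θ * (((n : ℝ) - mean (model C k a) (Real.exp (-s))) /
        stdDev (model C k a) (Real.exp (-s))) : ℝ) : ℂ)) =
      Complex.exp (-(Complex.I * ξ * modelMean k a s)) / value (model C k a) (Real.exp (-s)) *
      (((PowerSeries.coeff n (model C k a) : ℝ) : ℂ) *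
        Complex.exp (-s + Complex.I * ξ) ^ n) := by
    intro n
    have e1 : ((θ * (((n : ℝ) - mean (model C k a) (Real.exp (-s))) /
        stdDev (model C k a) (Real.exp (-s))) : ℝ)) = ξ * (n - modelMean k a s) := by
      rw [mean_model ha hC hs, stdDev, variance_model ha hC hs, hξ]
      ring
    have e2 : Complex.exp (Complex.I * ((ξ * (n - modelMean k a s) : ℝ) : ℂ)) =
        Complex.exp (-(Complex.I * ξ * modelMean k a s)) * Complex.exp (n * (Complex.I * ξ)) := by
      rw [← Complex.exp_add]
      push_cast
      ring_nf
    have e3 : Complex.exp (-s + Complex.I * ξ) ^ n =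
        Complex.exp (-(n * s)) * Complex.exp (n * (Complex.I * ξ)) := by
      rw [← Complex.exp_nat_mul, ← Complex.exp_add]
      ring_nf
    rw [e1, e2, e3, prob_exp_neg, Complex.real_smul]
    push_cast
    ring
  rw [charFunZ, expect, tsum_congr key, tsum_mul_left, h, hval, Complex.exp_sub,
    ← Complex.exp_nat_mul]
  have e4 : Complex.exp (Complex.I * ξ * (k - modelMean k a s)) =
      Complex.exp (-(Complex.I * ξ * modelMean k a s)) * Complex.exp (k * (-s + Complex.I * ξ)) /
        Complex.exp (-(k * s)) := by
    rw [← Complex.exp_add, ← Complex.exp_sub]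
    ring_nf
  rw [e4]
  have n1 := Complex.exp_ne_zero (-((k : ℂ) * s))
  have n2 := Complex.exp_ne_zero (logProd a (Real.exp (-s) : ℝ))
  field_simp

end Model

/-! ### The variance has exact order s^(-3) -/

section VarianceBounds

variable {a : ℕ → ℕ}

/-- The signs alternate, but for fixed n the inner sum is a positive multiple of ∑ (-1)^(k+1) k x^k
= x/(1 + x)². So the numerators can be dropped from the lower bound for the variance. -/
theorem expSum_alt_nonneg (ha : ∀ n, n < a n) {s : ℝ} (hs : 0 < s) :
    0 ≤ expSum (fun i => altCoeff i * (logExp a i : ℝ) * (logExp a i : ℝ)) (logExp a) s := by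
  have h := (admissible_alt ha).mul_cast.mul_cast.summable hs
  have hx : ∀ n, Real.exp (-(a n * s)) < 1 := fun n => by
    have : (0 : ℝ) < a n := by exact_mod_cast Nat.zero_lt_of_lt (ha n)
    rw [Real.exp_lt_one_iff]
    nlinarith
  refine (h.hasSum.prod_fiberwise (g := fun n => 16 * (a n : ℝ) ^ 2 *
    (Real.exp (-(a n * s)) / (1 + Real.exp (-(a n * s))) ^ 2)) fun n => ?_).nonneg
    fun n => by positivity
  have hr : ‖-Real.exp (-(a n * s))‖ < 1 := by
    rw [norm_neg, Real.norm_of_nonneg (Real.exp_pos _).le]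
    exact hx n
  have := (hasSum_coe_mul_geometric_of_norm_lt_one hr).mul_left (-16 * (a n : ℝ) ^ 2)
  have e : -16 * (a n : ℝ) ^ 2 * (-Real.exp (-(a n * s)) / (1 - -Real.exp (-(a n * s))) ^ 2) =
      16 * (a n : ℝ) ^ 2 * (Real.exp (-(a n * s)) / (1 + Real.exp (-(a n * s))) ^ 2) := by
    rw [sub_neg_eq_add]
    ring
  rw [e] at this
  refine this.congr_fun fun k => ?_
  have e2 : Real.exp (-((logExp a (n, k) : ℕ) * s)) = Real.exp (-(a n * s)) ^ k := by
    rw [← Real.exp_nat_mul, logExp]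
    push_cast
    ring_nf
  rw [e2, altCoeff, logExp, neg_pow]
  rcases Nat.eq_zero_or_pos k with rfl | hk
  · simp
  · have : (k : ℝ) ≠ 0 := by positivity
    push_cast
    field_simp
    ring

theorem cube_le_sum_sq_odd (N : ℕ) :
    (N : ℝ) ^ 3 ≤ ∑ n ∈ range N, ((oddSeq n : ℕ) : ℝ) ^ 2 := by
  induction N with
  | zero => simp
  | succ N ih =>
    rw [Finset.sum_range_succ, oddSeq]
    push_cast
    nlinarith [(Nat.cast_nonneg N : (0 : ℝ) ≤ N)]

/-- Only the terms with inner index 1 and n < N = ⌈1/s⌉ are kept. There (2n+1)s ≤ 2Ns - s < 2 + s ≤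
3, and the squares of the first N odd numbers add up to at least N³ ≥ s^(-3). -/
theorem le_expSum_pos {s : ℝ} (hs : 0 < s) (hs1 : s ≤ 1) :
    16 * Real.exp (-3) / s ^ 3 ≤
      expSum (fun i => posCoeff i * (logExp oddSeq i : ℝ) * (logExp oddSeq i : ℝ))
        (logExp oddSeq) s := by
  have h := admissible_pos.mul_cast.mul_cast.summable hs
  set N := ⌈1 / s⌉₊ with hN
  have hN1 : 1 / s ≤ N := Nat.le_ceil _
  have hN2 : (N : ℝ) < 1 / s + 1 := Nat.ceil_lt_add_one (by positivity)
  have hNs : N * s < 1 + s := by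
    have := mul_lt_mul_of_pos_right hN2 hs
    rwa [add_mul, one_div, inv_mul_cancel₀ hs.ne', one_mul] at this
  have h1 : 16 * Real.exp (-3) / s ^ 3 ≤
      ∑ n ∈ range N, 16 * ((oddSeq n : ℕ) : ℝ) ^ 2 * Real.exp (-3) := by
    have h3 : (1 / s) ^ 3 ≤ (N : ℝ) ^ 3 := by gcongr
    have := h3.trans (cube_le_sum_sq_odd N)
    rw [← Finset.sum_mul, ← Finset.mul_sum]
    calc 16 * Real.exp (-3) / s ^ 3 = 16 * (1 / s) ^ 3 * Real.exp (-3) := by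
          rw [one_div, inv_pow]; ring
      _ ≤ _ := by gcongr
  refine h1.trans (le_trans ?_ (h.sum_le_tsum (range N ×ˢ {1}) fun i _ => ?_))
  · rw [Finset.sum_product]
    refine Finset.sum_le_sum fun n hn => ?_
    have hn' : (n : ℝ) + 1 ≤ N := by exact_mod_cast Finset.mem_range.mp hn
    have hb : ((oddSeq n : ℕ) : ℝ) * s ≤ 3 := by
      rw [oddSeq]
      push_cast
      nlinarith
    simp only [Finset.sum_singleton, posCoeff, logExp, mul_one, Nat.cast_one, div_one]
    have : Real.exp (-3) ≤ Real.exp (-(((oddSeq n : ℕ) : ℝ) * s)) :=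
      Real.exp_le_exp.mpr (by linarith)
    calc _ ≤ 16 * ((oddSeq n : ℕ) : ℝ) ^ 2 * Real.exp (-(((oddSeq n : ℕ) : ℝ) * s)) := by gcongr
      _ = _ := by ring
  · simp only [posCoeff]
    positivity

theorem le_modelVar (ha : ∀ n, n < a n) {s : ℝ} (hs : 0 < s) (hs1 : s ≤ 1) :
    16 * Real.exp (-3) / s ^ 3 ≤ modelVar a s := by
  have := expSum_alt_nonneg ha hs
  have := le_expSum_pos hs hs1
  rw [modelVar]
  linarith

theorem exists_modelVar_le (ha : ∀ n, n < a n) :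
    ∃ K : ℝ, 0 < K ∧ ∀ s : ℝ, 0 < s → modelVar a s ≤ K / s ^ 3 := by
  have key : ∀ {a : ℕ → ℕ} {c : ℕ × ℕ → ℝ}, (∀ n, n < a n) →
      (∀ i, |c i| ≤ 16 * (1 / (i.2 : ℝ))) → ∀ {s : ℝ}, 0 < s →
      expSum (fun i => c i * (logExp a i : ℝ) * (logExp a i : ℝ)) (logExp a) s ≤
        16 * (2 ! * 2 ^ (2 + 1)) * (∑' k : ℕ, 1 / (k : ℝ) ^ 2) / s ^ (2 + 1) := by
    intro a c ha hc s hs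
    refine le_trans (Summable.tsum_le_tsum (fun i => ?_)
      ((admissible_logTerm ha hc).mul_cast.mul_cast.summable hs)
      (summable_logTerm ha hc 2 hs)) (tsum_logTerm_le ha hc 2 hs)
    simp only
    rw [mul_assoc (c i), ← pow_two]
    gcongr
    exact le_abs_self _
  have hz : 0 ≤ ∑' k : ℕ, 1 / (k : ℝ) ^ 2 := tsum_nonneg fun k => by positivity
  -- The factor 2 counts the two series; the final 1 makes K positive without evaluating the sum.
  refine ⟨2 * (16 * (2 ! * 2 ^ (2 + 1)) * (∑' k : ℕ, 1 / (k : ℝ) ^ 2)) + 1,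
    by positivity, fun s hs => ?_⟩
  have h1 := key lt_oddSeq abs_posCoeff_le hs
  have h2 := key ha abs_altCoeff_le hs
  have h3 : 0 ≤ 1 / s ^ 3 := by positivity
  rw [modelVar, add_div, mul_div_assoc]
  linarith

end VarianceBounds

/-! ### Pointwise convergence of the characteristic functions -/

section Pointwise

variable {C : ℝ} {k : ℕ} {a : ℕ → ℕ}

/-- The exponent of the characteristic function is close to `-θ² / 2`. -/
theorem exists_charFunZ_model_eq (ha : ∀ n, n < a n) (hC : 1 ≤ C) :
    ∃ K : ℝ, ∀ s : ℝ, 0 < s → s ≤ 1 → ∀ θ : ℝ, ∃ A : ℂ,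
      charFunZ (model C k a) (Real.exp (-s)) θ = Complex.exp A ∧
      ‖A - ((-(1 / 2) * θ ^ 2 : ℝ) : ℂ)‖ ≤ K * (|θ / √(modelVar a s)| ^ 3 / s ^ 4) := by
  -- Here 8 is the Taylor constant 4 for each of two series; the rest is `tsum_logTerm_le` at p = 3.
  refine ⟨8 * (16 * (3 ! * 2 ^ (3 + 1)) * (∑' k : ℕ, 1 / (k : ℝ) ^ 2)), fun s hs hs1 θ => ?_⟩
  have hV : 0 < modelVar a s := lt_of_lt_of_le (by positivity) (le_modelVar ha hs hs1)
  set ξ : ℝ := θ / √(modelVar a s) with hξ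
  have hξV : ξ ^ 2 * modelVar a s = θ ^ 2 := by
    rw [hξ, div_pow, Real.sq_sqrt hV.le]
    field_simp
  refine ⟨_, (charFunZ_model ha hC hs θ).trans (Complex.exp_add _ _).symm, ?_⟩
  rw [← hξ]
  have t1 := admissible_pos.norm_powSum_sub_taylor_le hs ξ
  have t2 := (admissible_alt ha).norm_powSum_sub_taylor_le hs ξ
  have b1 := tsum_logTerm_le lt_oddSeq abs_posCoeff_le 3 hs
  have b2 := tsum_logTerm_le ha abs_altCoeff_le 3 hs
  -- Centring cancels k and the first-order terms, and the second-order terms combine to ξ²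
  -- `modelVar a s` = θ². Two Taylor remainders are left.
  have e : Complex.I * ξ * (k - modelMean k a s) +
      (logProd a (Complex.exp (-s + Complex.I * ξ)) - logProd a (Real.exp (-s) : ℝ)) -
      ((-(1 / 2) * θ ^ 2 : ℝ) : ℂ) =
      (powSum posCoeff (logExp oddSeq) (Complex.exp (-s + Complex.I * ξ)) -
        (expSum posCoeff (logExp oddSeq) s : ℝ) -
        Complex.I * ξ * (expSum (fun i => posCoeff i * (logExp oddSeq i : ℝ))
          (logExp oddSeq) s : ℝ) +
        (ξ : ℂ) ^ 2 / 2 * (expSum (fun i => posCoeff i * (logExp oddSeq i : ℝ) *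
          (logExp oddSeq i : ℝ)) (logExp oddSeq) s : ℝ)) +
      (powSum altCoeff (logExp a) (Complex.exp (-s + Complex.I * ξ)) -
        (expSum altCoeff (logExp a) s : ℝ) -
        Complex.I * ξ * (expSum (fun i => altCoeff i * (logExp a i : ℝ)) (logExp a) s : ℝ) +
        (ξ : ℂ) ^ 2 / 2 * (expSum (fun i => altCoeff i * (logExp a i : ℝ) *
          (logExp a i : ℝ)) (logExp a) s : ℝ)) := by
    rw [← hξV, logProd, logProd, powSum_ofReal_exp, powSum_ofReal_exp, modelMean, modelVar]
    push_cast
    ring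
  rw [e]
  refine (norm_add_le _ _).trans ((add_le_add t1 t2).trans ?_)
  have hx : 0 ≤ 4 * |ξ| ^ 3 := by positivity
  have c1 := mul_le_mul_of_nonneg_left b1 hx
  have c2 := mul_le_mul_of_nonneg_left b2 hx
  refine (add_le_add c1 c2).trans (le_of_eq ?_)
  ring

theorem tendsto_charFunZ_model (ha : ∀ n, n < a n) (hC : 1 ≤ C) (θ : ℝ) :
    Tendsto (fun s => charFunZ (model C k a) (Real.exp (-s)) θ) (𝓝[>] 0)
      (𝓝 (Real.exp (-(1 / 2) * θ ^ 2) : ℂ)) := by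
  obtain ⟨K, hK⟩ := exists_charFunZ_model_eq (k := k) ha hC
  have hev : ∀ᶠ s : ℝ in 𝓝[>] 0, 0 < s ∧ s ≤ 1 := by
    filter_upwards [Ioc_mem_nhdsGT (zero_lt_one' ℝ)] with s hs using hs
  choose! A hA hA' using hK
  set c : ℝ := 16 * Real.exp (-3) with hc
  have hc0 : 0 < c := by positivity
  have hsmall : Tendsto (fun s : ℝ => K * (|θ / √(modelVar a s)| ^ 3 / s ^ 4)) (𝓝[>] 0)
      (𝓝 0) := by
    -- Since `modelVar a s` ≥ c/s³, the square of the error is θ⁶ / (V³ s⁸) ≤ θ⁶ s / c³, where V is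
    -- the variance.
    have h1 : Tendsto (fun s : ℝ => √(θ ^ 6 / c ^ 3 * s)) (𝓝[>] 0) (𝓝 0) := by
      have : Continuous fun s : ℝ => √(θ ^ 6 / c ^ 3 * s) := by fun_prop
      simpa using (this.tendsto 0).mono_left nhdsWithin_le_nhds
    have h2 : Tendsto (fun s : ℝ => |θ / √(modelVar a s)| ^ 3 / s ^ 4) (𝓝[>] 0) (𝓝 0) := by
      refine squeeze_zero' ?_ ?_ h1
      · filter_upwards [hev] with s hs
        have := hs.1
        positivity
      · filter_upwards [hev] with s hs
        have hs0 := hs.1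
        have hlow := le_modelVar ha hs.1 hs.2
        have hV : 0 < modelVar a s := lt_of_lt_of_le (by positivity) hlow
        refine Real.le_sqrt_of_sq_le ?_
        have e : (|θ / √(modelVar a s)| ^ 3 / s ^ 4) ^ 2 =
            θ ^ 6 / (modelVar a s ^ 3 * s ^ 8) := by
          have : (√(modelVar a s)) ^ 6 = modelVar a s ^ 3 := by
            rw [show (6 : ℕ) = 2 * 3 from rfl, pow_mul, Real.sq_sqrt hV.le]
          rw [div_pow, ← pow_mul, show |θ / √(modelVar a s)| ^ (3 * 2) = (θ / √(modelVar a s)) ^ 6 from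
              Even.pow_abs ⟨3, rfl⟩ _, div_pow, this, div_div, ← pow_mul]
        have e2 : θ ^ 6 / c ^ 3 * s = θ ^ 6 / ((c / s ^ 3) ^ 3 * s ^ 8) := by
          field_simp
        rw [e, e2]
        have h6 : 0 ≤ θ ^ 6 := by positivity
        gcongr
    simpa using h2.const_mul K
  have hlim : Tendsto (fun s => A s θ) (𝓝[>] 0) (𝓝 ((-(1 / 2) * θ ^ 2 : ℝ) : ℂ)) := by
    rw [tendsto_iff_norm_sub_tendsto_zero]
    refine squeeze_zero' (Eventually.of_forall fun s => norm_nonneg _) ?_ hsmall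
    filter_upwards [hev] with s hs
    exact hA' s hs.1 hs.2 θ
  rw [Complex.ofReal_exp]
  refine ((Complex.continuous_exp.tendsto _).comp hlim).congr' ?_
  filter_upwards [hev] with s hs
  exact (hA s hs.1 hs.2 θ).symm

end Pointwise

/-! ### Uniform decay on the whole circle -/

section Decay

/-- `|1 - (t exp(iξ))^b|² = (1 - t^b)² (1 + gap)` for `t = exp(-s)` and `b = 2n + 1`. -/
def gap (s ξ : ℝ) (n : ℕ) : ℝ :=
  2 * Real.exp (-(oddSeq n * s)) * (1 - Real.cos (oddSeq n * ξ)) /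
    (1 - Real.exp (-(oddSeq n * s))) ^ 2

theorem gap_nonneg (s ξ : ℝ) (n : ℕ) : 0 ≤ gap s ξ n := by
  have : 0 ≤ 1 - Real.cos (oddSeq n * ξ) := by linarith [Real.cos_le_one (oddSeq n * ξ)]
  rw [gap]
  positivity

theorem exp_neg_oddSeq_lt_one {s : ℝ} (hs : 0 < s) (n : ℕ) :
    Real.exp (-(oddSeq n * s)) < 1 := by
  have : (0 : ℝ) < oddSeq n := by exact_mod_cast Nat.zero_lt_of_lt (lt_oddSeq n)
  rw [Real.exp_lt_one_iff]
  nlinarith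

theorem ofReal_exp_neg_pow (s : ℝ) (m : ℕ) :
    ((Real.exp (-s) : ℝ) : ℂ) ^ m = (Real.exp (-(m * s)) : ℝ) := by
  rw [← Complex.ofReal_pow, ← Real.exp_nat_mul, mul_neg]

theorem norm_one_sub_pow_sq {s : ℝ} (hs : 0 < s) (ξ : ℝ) (n : ℕ) :
    ‖1 - Complex.exp (-s + Complex.I * ξ) ^ (2 * n + 1)‖ ^ 2 =
      ‖1 - ((Real.exp (-s) : ℝ) : ℂ) ^ (2 * n + 1)‖ ^ 2 * (1 + gap s ξ n) := by
  have hx := exp_neg_oddSeq_lt_one hs n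
  have e1 : Complex.exp (-s + Complex.I * ξ) ^ oddSeq n =
      (Real.exp (-(oddSeq n * s)) : ℝ) * Complex.exp ((oddSeq n * ξ : ℝ) * Complex.I) := by
    rw [← Complex.exp_nat_mul, Complex.ofReal_exp, ← Complex.exp_add]
    push_cast
    ring_nf
  change ‖1 - Complex.exp (-s + Complex.I * ξ) ^ oddSeq n‖ ^ 2 =
    ‖1 - ((Real.exp (-s) : ℝ) : ℂ) ^ oddSeq n‖ ^ 2 * (1 + gap s ξ n)
  rw [e1, ofReal_exp_neg_pow, gap]
  set x := Real.exp (-(oddSeq n * s))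
  have e2 : ‖(1 : ℂ) - (x : ℂ)‖ ^ 2 = (1 - x) ^ 2 := by
    rw [← Complex.ofReal_one, ← Complex.ofReal_sub, Complex.norm_real, Real.norm_eq_abs, sq_abs]
  have hne : (1 - x) ≠ 0 := by linarith
  rw [e2, Complex.sq_norm, Complex.normSq_apply]
  simp only [Complex.sub_re, Complex.sub_im, Complex.one_re, Complex.one_im,
    Complex.re_ofReal_mul, Complex.im_ofReal_mul, Complex.exp_ofReal_mul_I_re,
    Complex.exp_ofReal_mul_I_im]
  field_simp
  linear_combination x ^ 2 * Real.sin_sq_add_cos_sq (oddSeq n * ξ)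

/-- By the triangle inequality the numerator is largest on the positive axis, so the decay comes
from the denominator; the 16th power of a modulus is the 8th power of its square. -/
theorem norm_factorFun_le (a : ℕ → ℕ) {s : ℝ} (hs : 0 < s) (ξ : ℝ) (n : ℕ) :
    ‖factorFun a n (Complex.exp (-s + Complex.I * ξ))‖ ≤
      ‖factorFun a n (Real.exp (-s) : ℝ)‖ * ((1 + gap s ξ n) ^ 8)⁻¹ := by
  have h1 : ‖1 + Complex.exp (-s + Complex.I * ξ) ^ a n‖ ≤
      ‖1 + ((Real.exp (-s) : ℝ) : ℂ) ^ a n‖ := by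
    have e : ‖1 + ((Real.exp (-s) : ℝ) : ℂ) ^ a n‖ = 1 + Real.exp (-s) ^ a n := by
      rw [← Complex.ofReal_pow, ← Complex.ofReal_one, ← Complex.ofReal_add, Complex.norm_real,
        Real.norm_of_nonneg (by positivity)]
    rw [e]
    refine (norm_add_le _ _).trans ?_
    rw [norm_one, norm_pow, Complex.norm_exp]
    simp
  have h2 : ‖1 - Complex.exp (-s + Complex.I * ξ) ^ (2 * n + 1)‖ ^ 16 =
      ‖1 - ((Real.exp (-s) : ℝ) : ℂ) ^ (2 * n + 1)‖ ^ 16 * (1 + gap s ξ n) ^ 8 := by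
    rw [show (16 : ℕ) = 2 * 8 from rfl, pow_mul, norm_one_sub_pow_sq hs, mul_pow, ← pow_mul]
  simp only [factorFun, norm_pow, norm_mul, norm_inv, mul_pow, inv_pow]
  rw [h2, mul_inv, mul_assoc]
  gcongr

theorem one_add_sum_le_prod {g : ℕ → ℝ} (hg : ∀ n, 0 ≤ g n) (N : ℕ) :
    1 + ∑ n ∈ range N, g n ≤ ∏ n ∈ range N, (1 + g n) := by
  induction N with
  | zero => simp
  | succ N ih =>
    rw [Finset.sum_range_succ, Finset.prod_range_succ]
    have h := Finset.sum_nonneg fun n (_ : n ∈ range N) => hg n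
    nlinarith [hg N, mul_nonneg h (hg N), mul_le_mul_of_nonneg_right ih (hg N)]

/-- Every factor gains (1 + gap)^(-8), and as gaps are nonnegative any finite set of them may be
kept; their product is bounded below by 1 plus the sum. -/
theorem norm_exp_logProd_le {a : ℕ → ℕ} (ha : ∀ n, n < a n) {s : ℝ} (hs : 0 < s) (ξ : ℝ)
    (M : ℕ) :
    ‖Complex.exp (logProd a (Complex.exp (-s + Complex.I * ξ)) -
      logProd a (Real.exp (-s) : ℝ))‖ ≤ ((1 + ∑ n ∈ range M, gap s ξ n) ^ 8)⁻¹ := by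
  have hz : ‖Complex.exp (-s + Complex.I * ξ)‖ = Real.exp (-s) := by
    rw [Complex.norm_exp]
    simp
  have ht : ‖((Real.exp (-s) : ℝ) : ℂ)‖ = Real.exp (-s) := by
    rw [Complex.norm_real, Real.norm_of_nonneg (Real.exp_pos _).le]
  have h1 := (tendsto_prod_factorFun ha hs hz).norm
  have h2 := (tendsto_prod_factorFun ha hs ht).norm.mul_const
    ((1 + ∑ n ∈ range M, gap s ξ n) ^ 8)⁻¹
  have hS : ∀ N, 0 ≤ ∑ n ∈ range N, gap s ξ n := fun N =>
    Finset.sum_nonneg fun n _ => gap_nonneg s ξ n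
  have h3 := le_of_tendsto_of_tendsto h1 h2 (eventually_atTop.mpr ⟨M, fun N hN => ?_⟩)
  · rw [Complex.exp_sub, norm_div, div_le_iff₀ (norm_pos_iff.mpr (Complex.exp_ne_zero _))]
    exact h3.trans_eq (mul_comm _ _)
  · have h4 : 1 + ∑ n ∈ range M, gap s ξ n ≤ ∏ n ∈ range N, (1 + gap s ξ n) := by
      refine le_trans ?_ (one_add_sum_le_prod (gap_nonneg s ξ) N)
      exact add_le_add_right (Finset.sum_le_sum_of_subset_of_nonneg
        (Finset.range_subset_range.mpr hN) fun n _ _ => gap_nonneg s ξ n) 1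
    have hM := hS M
    simp only [norm_prod]
    calc ∏ n ∈ range N, ‖factorFun a n (Complex.exp (-s + Complex.I * ξ))‖
        ≤ ∏ n ∈ range N, (‖factorFun a n (Real.exp (-s) : ℝ)‖ * ((1 + gap s ξ n) ^ 8)⁻¹) :=
          Finset.prod_le_prod (fun n _ => norm_nonneg _)
            fun n _ => norm_factorFun_le a hs ξ n
      _ = (∏ n ∈ range N, ‖factorFun a n (Real.exp (-s) : ℝ)‖) *
          ((∏ n ∈ range N, (1 + gap s ξ n)) ^ 8)⁻¹ := by
          rw [Finset.prod_mul_distrib, Finset.prod_inv_distrib, Finset.prod_pow]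
      _ ≤ _ := by
          have : 0 ≤ ∏ n ∈ range N, ‖factorFun a n (Real.exp (-s) : ℝ)‖ :=
            Finset.prod_nonneg fun n _ => norm_nonneg _
          gcongr

/-- The constant in the decay estimate of the characteristic functions. -/
def decayConst : ℝ := 4 * Real.exp (-Real.pi) / Real.pi ^ 2

theorem decayConst_pos : 0 < decayConst := by
  have := Real.pi_pos
  rw [decayConst]
  positivity

theorem decayConst_le_one : decayConst ≤ 1 := by
  have h1 := Real.pi_gt_three
  have h2 : Real.exp (-Real.pi) ≤ 1 := Real.exp_le_one_iff.mpr (by linarith)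
  rw [decayConst, div_le_one (by positivity)]
  nlinarith

/-- With b = 2n+1: 1 - cos(bξ) ≥ 2(bξ)²/π², 1 - exp(-bs) ≤ bs and exp(-bs) ≥ exp(-π). The factor b²
cancels, so the bound does not depend on n. -/
theorem le_gap {s ξ : ℝ} (hs : 0 < s) {n : ℕ} (h1 : oddSeq n * s ≤ Real.pi)
    (h2 : oddSeq n * |ξ| ≤ Real.pi) : decayConst * ξ ^ 2 / s ^ 2 ≤ gap s ξ n := by
  have hx := exp_neg_oddSeq_lt_one hs n
  have hb : (0 : ℝ) < oddSeq n := by exact_mod_cast Nat.zero_lt_of_lt (lt_oddSeq n)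
  have hcos := Real.cos_le_one_sub_mul_cos_sq (x := oddSeq n * ξ)
    (by rwa [abs_mul, Nat.abs_cast])
  have hx1 : Real.exp (-Real.pi) ≤ Real.exp (-(oddSeq n * s)) :=
    Real.exp_le_exp.mpr (by linarith)
  have hx2 : 1 - Real.exp (-(oddSeq n * s)) ≤ oddSeq n * s := by
    linarith [Real.one_sub_le_exp_neg (oddSeq n * s)]
  have hpi := Real.pi_pos
  rw [gap]
  set x := Real.exp (-(oddSeq n * s))
  have hx3 : 0 < 1 - x := by linarith
  calc decayConst * ξ ^ 2 / s ^ 2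
      = 2 * Real.exp (-Real.pi) * (2 / Real.pi ^ 2 * (oddSeq n * ξ) ^ 2) /
          (oddSeq n * s) ^ 2 := by
        rw [decayConst]
        field_simp
        ring
    _ ≤ 2 * x * (1 - Real.cos (oddSeq n * ξ)) / (1 - x) ^ 2 := by
        have h3 : 2 / Real.pi ^ 2 * (oddSeq n * ξ) ^ 2 ≤ 1 - Real.cos (oddSeq n * ξ) := by
          linarith
        have h4 : 0 ≤ 2 / Real.pi ^ 2 * (oddSeq n * ξ) ^ 2 := by positivity
        have h5 : 0 ≤ 1 - Real.cos (oddSeq n * ξ) := h4.trans h3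
        gcongr

theorem exists_le_sum_gap {s ξ : ℝ} (hs : 0 < s) (hs1 : s ≤ 1) (hξ : |ξ| ≤ Real.pi) :
    ∃ M : ℕ, decayConst * ξ ^ 2 / s ^ 2 / max s |ξ| ≤ ∑ n ∈ range M, gap s ξ n := by
  have hpi := Real.pi_gt_three
  have hc := decayConst_pos
  set u := max s |ξ| with hu
  have hsu : s ≤ u := le_max_left _ _
  have hξu : |ξ| ≤ u := le_max_right _ _
  have hu0 : 0 < u := hs.trans_le hsu
  have huπ : u ≤ Real.pi := max_le (by linarith) hξ
  have hB : 1 ≤ Real.pi / u := by rwa [one_le_div hu0]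
  have hBu : Real.pi / u * u = Real.pi := div_mul_cancel₀ _ hu0.ne'
  set B := Real.pi / u
  -- This M counts the odd numbers up to B, exactly those to which `le_gap` is applied.
  refine ⟨⌊(B + 1) / 2⌋₊, ?_⟩
  set M := ⌊(B + 1) / 2⌋₊
  have hM1 : (B + 1) / 2 < M + 1 := Nat.lt_floor_add_one _
  have hM2 : (M : ℝ) ≤ (B + 1) / 2 := Nat.floor_le (by positivity)
  have hM3 : (1 : ℝ) ≤ M := by
    exact_mod_cast Nat.le_floor (by push_cast; linarith)
  -- M ≥ 1 settles B ≤ 3, and M > (B - 1)/2 settles B ≥ 3. As π > 3, this gives M ≥ 1/u.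
  have hM : B / 3 ≤ M := by
    rcases le_total B 3 with h | h <;> linarith
  have hterm : ∀ n ∈ range M, decayConst * ξ ^ 2 / s ^ 2 ≤ gap s ξ n := by
    intro n hn
    have hn' : (n : ℝ) + 1 ≤ M := by exact_mod_cast Finset.mem_range.mp hn
    have hb : ((oddSeq n : ℕ) : ℝ) ≤ B := by
      rw [oddSeq]
      push_cast
      linarith
    refine le_gap hs ?_ ?_
    · calc (oddSeq n : ℝ) * s ≤ B * u := by gcongr
        _ = Real.pi := hBu
    · calc (oddSeq n : ℝ) * |ξ| ≤ B * u := by gcongr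
        _ = Real.pi := hBu
  have hsum := Finset.card_nsmul_le_sum _ _ _ hterm
  rw [Finset.card_range, nsmul_eq_mul] at hsum
  refine le_trans ?_ hsum
  have h1 : 1 / u ≤ M := by
    refine le_trans ?_ hM
    rw [div_div, div_le_div_iff₀ hu0 (by positivity)]
    nlinarith
  have h2 : 0 ≤ decayConst * ξ ^ 2 / s ^ 2 := by positivity
  calc decayConst * ξ ^ 2 / s ^ 2 / u = 1 / u * (decayConst * ξ ^ 2 / s ^ 2) := by ring
    _ ≤ _ := by gcongr

theorem norm_exp_logProd_le_inv {a : ℕ → ℕ} (ha : ∀ n, n < a n) {s ξ : ℝ} (hs : 0 < s)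
    (hs1 : s ≤ 1) (hξ : |ξ| ≤ Real.pi) :
    ‖Complex.exp (logProd a (Complex.exp (-s + Complex.I * ξ)) -
      logProd a (Real.exp (-s) : ℝ))‖ ≤ (1 + decayConst ^ 2 * ξ ^ 2 / s ^ 3)⁻¹ := by
  obtain ⟨M, hM⟩ := exists_le_sum_gap hs hs1 hξ
  refine (norm_exp_logProd_le ha hs ξ M).trans ?_
  have hc := decayConst_pos
  have hc1 := decayConst_le_one
  set S := ∑ n ∈ range M, gap s ξ n
  have hS : 0 ≤ S := Finset.sum_nonneg fun n _ => gap_nonneg s ξ n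
  -- For |ξ| ≤ s the sum S itself is of order ξ²/s³. For |ξ| ≥ s it is only of order |ξ|/s², but its
  -- square is of order ξ²/s⁴. Two of the eight powers of 1 + S cover both cases.
  have key : decayConst ^ 2 * ξ ^ 2 / s ^ 3 ≤ S + S ^ 2 := by
    rcases le_total |ξ| s with h | h
    · rw [max_eq_left h] at hM
      have : decayConst ^ 2 * ξ ^ 2 / s ^ 3 ≤ decayConst * ξ ^ 2 / s ^ 2 / s := by
        rw [div_div, ← pow_succ]
        gcongr
        nlinarith
      nlinarith
    · rw [max_eq_right h] at hM
      have hξ0 : 0 < |ξ| := hs.trans_le h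
      have e : decayConst * ξ ^ 2 / s ^ 2 / |ξ| = decayConst * |ξ| / s ^ 2 := by
        rw [← sq_abs ξ]
        field_simp
      rw [e] at hM
      have h2 : (decayConst * |ξ| / s ^ 2) ^ 2 ≤ S ^ 2 := by gcongr
      have h3 : decayConst ^ 2 * ξ ^ 2 / s ^ 3 ≤ (decayConst * |ξ| / s ^ 2) ^ 2 := by
        rw [div_pow, mul_pow, sq_abs, ← pow_mul]
        exact div_le_div_of_nonneg_left (by positivity) (by positivity)
          (pow_le_pow_of_le_one hs.le hs1 (by norm_num))
      linarith
  have h8 : (1 + S) ^ 2 ≤ (1 + S) ^ 8 := pow_le_pow_right₀ (by linarith) (by norm_num)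
  gcongr
  nlinarith

end Decay

/-! ### Passage to the limit by dominated convergence -/

theorem tendsto_id_comap_ofReal :
    Tendsto id (comap ENNReal.ofReal (𝓝[<] 1)) (𝓝[<] (1 : ℝ)) := by
  have hc : Tendsto ENNReal.ofReal (comap ENNReal.ofReal (𝓝[<] 1)) (𝓝[<] 1) := tendsto_comap
  have hc' := hc.mono_right nhdsWithin_le_nhds
  refine tendsto_nhdsWithin_iff.mpr ⟨?_, ?_⟩
  · have h := (ENNReal.tendsto_toReal ENNReal.one_ne_top).comp hc'
    rw [ENNReal.toReal_one] at h
    refine h.congr' ?_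
    filter_upwards [hc'.eventually (lt_mem_nhds zero_lt_one)] with t ht
    exact ENNReal.toReal_ofReal (ENNReal.ofReal_pos.mp ht).le
  · filter_upwards [hc.eventually self_mem_nhdsWithin] with t ht
    exact ENNReal.ofReal_lt_one.mp ht

theorem tendsto_neg_log_nhdsLT_one :
    Tendsto (fun t => -Real.log t) (𝓝[<] 1) (𝓝[>] 0) := by
  refine tendsto_nhdsWithin_iff.mpr ⟨?_, ?_⟩
  · have h : Tendsto (fun t => -Real.log t) (𝓝 1) (𝓝 (-Real.log 1)) :=
      (Real.continuousAt_log one_ne_zero).neg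
    rw [Real.log_one, neg_zero] at h
    exact h.mono_left nhdsWithin_le_nhds
  · filter_upwards [Ioo_mem_nhdsLT (zero_lt_one' ℝ)] with t ht
    exact neg_pos.mpr (Real.log_neg ht.1 ht.2)

theorem integrable_inv_one_add_mul_sq {c : ℝ} (hc : 0 < c) :
    MeasureTheory.Integrable fun θ : ℝ => (1 + c * θ ^ 2)⁻¹ := by
  have h := integrable_inv_one_add_sq.comp_mul_left' (Real.sqrt_pos.mpr hc).ne'
  refine h.congr (Eventually.of_forall fun θ => ?_)
  simp only [mul_pow, Real.sq_sqrt hc.le]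

/-- The strong Gaussian limit follows by dominated convergence from the pointwise convergence of
the characteristic functions and a uniform quadratic decay. -/
theorem tendsto_integral_charFunZ {F : PowerSeries ℝ} {c : ℝ} (hc : 0 < c)
    (hcont : ∀ᶠ s : ℝ in 𝓝[>] 0, Continuous (charFunZ F (Real.exp (-s))))
    (hlim : ∀ θ, Tendsto (fun s => charFunZ F (Real.exp (-s)) θ) (𝓝[>] 0)
      (𝓝 (Real.exp (-(1 / 2) * θ ^ 2) : ℂ)))
    (hdom : ∀ᶠ s : ℝ in 𝓝[>] 0, ∀ θ, |θ| ≤ Real.pi * stdDev F (Real.exp (-s)) →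
      ‖charFunZ F (Real.exp (-s)) θ‖ ≤ (1 + c * θ ^ 2)⁻¹) :
    Tendsto (fun s : ℝ => ∫ θ in (-(Real.pi * stdDev F (Real.exp (-s))))..(Real.pi *
      stdDev F (Real.exp (-s))),
      ‖charFunZ F (Real.exp (-s)) θ - (Real.exp (-(1 / 2) * θ ^ 2) : ℂ)‖) (𝓝[>] 0) (𝓝 0) := by
  -- The interval varies with s, so the integrand is extended by zero to the whole line.
  let I : ℝ → Set ℝ := fun s => Set.Ioc (-(Real.pi * stdDev F (Real.exp (-s))))
    (Real.pi * stdDev F (Real.exp (-s)))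
  let f : ℝ → ℝ → ℝ := fun s θ =>
    ‖charFunZ F (Real.exp (-s)) θ - (Real.exp (-(1 / 2) * θ ^ 2) : ℂ)‖
  have hg : Continuous fun θ : ℝ => ((Real.exp (-(1 / 2) * θ ^ 2) : ℝ) : ℂ) := by fun_prop
  have key : Tendsto (fun s => ∫ θ, (I s).indicator (f s) θ) (𝓝[>] 0)
      (𝓝 (∫ _ : ℝ, (0 : ℝ))) := by
    refine MeasureTheory.tendsto_integral_filter_of_dominated_convergence
      (fun θ => (1 + c * θ ^ 2)⁻¹ + Real.exp (-(1 / 2) * θ ^ 2)) ?_ ?_ ?_ ?_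
    · filter_upwards [hcont] with s hs
      exact ((hs.sub hg).norm.measurable.indicator measurableSet_Ioc).aestronglyMeasurable
    · filter_upwards [hdom] with s hs
      refine Eventually.of_forall fun θ => ?_
      by_cases hθ : θ ∈ I s
      swap
      · rw [Set.indicator_of_notMem hθ, norm_zero]
        positivity
      rw [Set.indicator_of_mem hθ, norm_norm]
      refine (norm_sub_le _ _).trans (add_le_add (hs θ (abs_le.mpr ⟨hθ.1.le, hθ.2⟩)) ?_)
      rw [Complex.norm_real, Real.norm_of_nonneg (Real.exp_pos _).le]
    · exact (integrable_inv_one_add_mul_sq hc).add (integrable_exp_neg_mul_sq (by norm_num))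
    · refine Eventually.of_forall fun θ => ?_
      refine squeeze_zero (fun s => Set.indicator_nonneg (fun θ _ => norm_nonneg _) θ)
        (fun s => Set.indicator_le_self' (fun θ _ => norm_nonneg _) θ) ?_
      exact tendsto_iff_norm_sub_tendsto_zero.mp (hlim θ)
  rw [MeasureTheory.integral_zero] at key
  refine key.congr fun s => ?_
  have hle : -(Real.pi * stdDev F (Real.exp (-s))) ≤ Real.pi * stdDev F (Real.exp (-s)) := by
    have : 0 ≤ Real.pi * stdDev F (Real.exp (-s)) :=
      mul_nonneg Real.pi_pos.le (Real.sqrt_nonneg _)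
    linarith
  rw [intervalIntegral.integral_of_le hle, MeasureTheory.integral_indicator measurableSet_Ioc]

section Model

variable {C : ℝ} {k : ℕ} {a : ℕ → ℕ}

/-- The probabilities are a summable majorant. Continuity provides the measurability needed for
dominated convergence. -/
theorem continuous_charFunZ_model (ha : ∀ n, n < a n) {s : ℝ} (hs : 0 < s) :
    Continuous (charFunZ (model C k a) (Real.exp (-s))) := by
  refine continuous_tsum (u := fun n => |prob (model C k a) (Real.exp (-s)) n|)
    (fun n => by fun_prop) ?_ fun n θ => ?_
  · refine (((admissible_model (C := C) (k := k) ha).summable hs).div_const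
      (value (model C k a) (Real.exp (-s)))).abs.congr fun n => ?_
    rw [prob_exp_neg, id]
  · rw [norm_smul, Complex.norm_exp_I_mul_ofReal, mul_one, Real.norm_eq_abs]

/-- The range |θ| ≤ πσ is |ξ| ≤ π, and ξ²/s³ = θ²/(σ²s³) ≥ θ²/K turns the decay in ξ into decay in θ
uniform in s. -/
theorem exists_norm_charFunZ_model_le (ha : ∀ n, n < a n) (hC : 1 ≤ C) :
    ∃ c : ℝ, 0 < c ∧ ∀ s : ℝ, 0 < s → s ≤ 1 → ∀ θ : ℝ,
      |θ| ≤ Real.pi * stdDev (model C k a) (Real.exp (-s)) →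
      ‖charFunZ (model C k a) (Real.exp (-s)) θ‖ ≤ (1 + c * θ ^ 2)⁻¹ := by
  obtain ⟨K, hK0, hK⟩ := exists_modelVar_le ha
  have hd := decayConst_pos
  refine ⟨decayConst ^ 2 / K, by positivity, fun s hs hs1 θ hθ => ?_⟩
  have hV : 0 < modelVar a s := lt_of_lt_of_le (by positivity) (le_modelVar ha hs hs1)
  rw [stdDev, variance_model ha hC hs] at hθ
  have hξ : |θ / √(modelVar a s)| ≤ Real.pi := by
    rw [abs_div, abs_of_nonneg (Real.sqrt_nonneg _), div_le_iff₀ (Real.sqrt_pos.mpr hV)]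
    exact hθ
  have h1 : ‖Complex.exp (Complex.I * ((θ / √(modelVar a s) : ℝ) : ℂ) *
      (k - modelMean k a s))‖ = 1 := by
    have := Complex.norm_exp_I_mul_ofReal (θ / √(modelVar a s) * (k - modelMean k a s))
    push_cast at this ⊢
    rwa [mul_assoc]
  rw [charFunZ_model ha hC hs, norm_mul, h1, one_mul]
  refine (norm_exp_logProd_le_inv ha hs hs1 hξ).trans ?_
  have h2 : modelVar a s * s ^ 3 ≤ K := by
    have := hK s hs
    rwa [le_div_iff₀ (by positivity)] at this
  have h3 : decayConst ^ 2 / K * θ ^ 2 ≤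
      decayConst ^ 2 * (θ / √(modelVar a s)) ^ 2 / s ^ 3 := by
    rw [div_pow, Real.sq_sqrt hV.le]
    calc decayConst ^ 2 / K * θ ^ 2 = decayConst ^ 2 * θ ^ 2 / K := by ring
      _ ≤ decayConst ^ 2 * θ ^ 2 / (modelVar a s * s ^ 3) := by gcongr
      _ = _ := by field_simp
  gcongr

theorem strongGaussian_model (ha : ∀ n, n < a n) (hC : 1 ≤ C) :
    StrongGaussianCondition (model C k a) where
  ne_zero h := by
    have := one_le_coeff_model (k := k) ha hC 0
    rw [h, map_zero] at this
    norm_num at this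
  coeff_nonneg := coeffNonneg_model ha hC
  radius_pos := by
    rw [radius_model ha hC]
    exact one_pos
  tendsto := by
    rw [radius_model ha hC]
    obtain ⟨c, hc, hbound⟩ := exists_norm_charFunZ_model_le (k := k) ha hC
    have hev : ∀ᶠ s : ℝ in 𝓝[>] 0, 0 < s ∧ s ≤ 1 := by
      filter_upwards [Ioc_mem_nhdsGT (zero_lt_one' ℝ)] with s hs using hs
    have key := tendsto_integral_charFunZ hc
      (hev.mono fun s hs => continuous_charFunZ_model (C := C) (k := k) ha hs.1)
      (tendsto_charFunZ_model ha hC) (hev.mono fun s hs => hbound s hs.1 hs.2)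
    have key' := (key.comp tendsto_neg_log_nhdsLT_one).congr' (f₂ := fun t : ℝ =>
      ∫ θ in (-(Real.pi * stdDev (model C k a) t))..(Real.pi * stdDev (model C k a) t),
        ‖charFunZ (model C k a) t θ - (Real.exp (-(1 / 2) * θ ^ 2) : ℂ)‖) (by
      filter_upwards [Ioo_mem_nhdsLT (zero_lt_one' ℝ)] with t ht
      simp only [Function.comp_apply, neg_neg, Real.exp_log ht.1])
    exact key'.comp tendsto_id_comap_ofReal

end Model

/-! ### The two series of the theorem -/

theorem H2Star_eq_model : H2Star = model (2 ^ 7) 0 oddSeq := by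
  rw [H2Star, model, PowerSeries.monomial_eq_C_mul_X_pow, map_pow, map_ofNat, pow_zero, mul_one]
  rfl

theorem H3Star_eq_model : H3Star = model (2 ^ 15) 2 (fun n => 2 * n + 2) := by
  rw [H3Star, model, PowerSeries.monomial_eq_C_mul_X_pow, map_pow, map_ofNat]
  rfl

end

end StrongGaussian

theorem theorem3p3 :
    (StrongGaussian.radius StrongGaussian.H2Star = 1 ∧
      StrongGaussian.StrongGaussianCondition StrongGaussian.H2Star) ∧
    (StrongGaussian.radius StrongGaussian.H3Star = 1 ∧
      StrongGaussian.StrongGaussianCondition StrongGaussian.H3Star) := by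
  have h3 : ∀ n : ℕ, n < 2 * n + 2 := fun n => by omega
  rw [StrongGaussian.H2Star_eq_model, StrongGaussian.H3Star_eq_model]
  exact ⟨⟨StrongGaussian.radius_model StrongGaussian.lt_oddSeq (by norm_num),
      StrongGaussian.strongGaussian_model StrongGaussian.lt_oddSeq (by norm_num)⟩,
    StrongGaussian.radius_model h3 (by norm_num),
    StrongGaussian.strongGaussian_model h3 (by norm_num)⟩
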